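/- Let $M$ be a smooth manifold (finite-dimensional, Hausdorff, second countable, without boundary) and $E\to M$ a smooth real vector bundle of finite rank, with space of smooth sections $\Gamma(E)$. **Gauge algebroid.** For $m\in M$ let $(\mathfrak D E)_m$ be the space of $\mathbb R$-linear operators $\mathfrak d:\Gamma(E)\to E_m$ together with a tangent vector $\alpha(\mathfrak d)\in T_mM$ (the anchor) such that $\mathfrak d(fu)=f(m)\,\mathfrak d(u)+\alpha(\mathfrak d)(f)\,u(m)$ for all $f\in C^\infty(M)$, $u\in\Gamma(E)$. It contains $\mathfrak{gl}(E_m)$ (with zero anchor) via $\Phi\mapsto(u\mapsto\Phi(u(m)))$. The bracket $[\cdot,\cdot]_{\mathfrak D}$ on $\Gamma(\mathfrak D E)$ is the commutator. **Jet bundle.** The first jet bundle of $E$ is identified with its description as the standard $E$-dual of $\mathfrak D E$: $$(\mathfrak J E)_m=\{\nu\in\mathrm{Hom}((\mathfrak D E)_m,E_m)\;:\;\nu(\Phi)=\Phi(\nu(\mathbf 1))\ \ \forall\,\Phi\in\mathfrak{gl}(E_m)\},$$ with the $E$-valued pairing $\langle\mu,\mathfrak d\rangle_E=\mu(\mathfrak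 d)$; the jet prolongation $\mathbb d:\Gamma(E)\to\Gamma(\mathfrak J E)$ is $\langle\mathbb d u,\mathfrak d\rangle_E=\mathfrak d u$. **Omni-Lie algebroid.** Let $\mathcal E=\mathfrak D E\oplus\mathfrak J E$, with the symmetric form $(\mathfrak d+\mu,\mathfrak r+\nu)_E=\tfrac12(\langle\nu,\mathfrak d\rangle_E+\langle\mu,\mathfrak r\rangle_E)$ and, on $\Gamma(\mathcal E)$, the Dorfman bracket $$\{\mathfrak d+\mu,\mathfrak r+\nu\}=[\mathfrak d,\mathfrak r]_{\mathfrak D}+\mathcal L_{\mathfrak d}\nu-\mathcal L_{\mathfrak r}\mu+\mathbb d\langle\mu,\mathfrak r\rangle_E,$$ where $\mathcal L_{\mathfrak d}\mu\in\Gamma(\mathfrak J E)$ is defined by $\langle\mathcal L_{\mathfrak d}\mu,\mathfrak d'\rangle_E=\mathfrak d\langle\mu,\mathfrak d'\rangle_E-\langle\mu,[\mathfrak d,\mathfrak d']_{\mathfrak D}\rangle_E$ for all $\mathfrak d'\in\Gamma(\mathfrak D E)$. A *Dirac structure* in $\mathcal E$ is a smooth subbundle $L\subset\mathcal E$ that is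 maximal isotropic for $(\cdot,\cdot)_E$ and whose space of sections $\Gamma(L)$ is closed under the Dorfman bracket. A smooth bundle map $\pi:\mathfrak J E\to\mathfrak D E$ over $\mathrm{id}_M$ has graph $L_\pi=\{(\pi(\mu),\mu):\mu\in\mathfrak J E\}$. A *Lie algebroid structure* on $E$ is a pair of a smooth bundle map $\rho_E:E\to TM$ over $\mathrm{id}_M$ and a real Lie bracket $[\cdot,\cdot]_E$ on $\Gamma(E)$ such that $[u,fv]_E=f[u,v]_E+(\rho_E(u)f)\,v$ for all $u,v\in\Gamma(E)$, $f\in C^\infty(M)$. **Theorem.** If $\mathrm{rank}(E)\ge 2$, there is a one-to-one correspondence between Lie algebroid structures on $E$ and Dirac structures in $\mathcal E=\mathfrak D E\oplus\mathfrak J E$ that are graphs $L_\pi$ of smooth bundle maps $\pi:\mathfrak J E\to\mathfrak D E$. Under it, $([\cdot,\cdot]_E,\rho_E)$ corresponds to the $L_\pi$ with $$\pi(\mathbb d u)=[u,\cdot\,]_E,\qquad \rho_E(u)=\alpha(\pi(\mathbb d u))\qquad\text{for all }u\in\Gamma(E).$$ -/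

import Mathlib

open Bundle VectorField
open scoped Manifold ContDiff Topology

noncomputable section

namespace OmniLie

section VectorFields

theorem contMDiff_mvfderiv_apply {B : Type*} [NormedAddCommGroup B] [NormedSpace ℝ B] {H : Type*}
    [TopologicalSpace H] {I : ModelWithCorners ℝ B H} {M : Type*} [TopologicalSpace M]
    [ChartedSpace H M] [IsManifold I ∞ M] {f : M → ℝ} {X : Π x : M, TangentSpace I x}
    (hf : ContMDiff I 𝓘(ℝ, ℝ) ∞ f)
    (hX : ContMDiff I I.tangent ∞ (fun x => (⟨x, X x⟩ : TangentBundle I M))) :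
    ContMDiff I 𝓘(ℝ, ℝ) ∞ (fun x => mvfderiv I f x (X x)) := by
  have h1 := (hf.contMDiff_tangentMap (m := ∞) (by simp)).comp hX
  exact (contMDiff_snd_tangentBundle_modelSpace ℝ 𝓘(ℝ, ℝ)).comp h1

theorem mvfderiv_chart {B : Type*} [NormedAddCommGroup B] [NormedSpace ℝ B] {H : Type*}
    [TopologicalSpace H] {I : ModelWithCorners ℝ B H} {M : Type*} [TopologicalSpace M]
    [ChartedSpace H M] [IsManifold I ∞ M] {g : M → ℝ} (hg : ContMDiff I 𝓘(ℝ, ℝ) ∞ g)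
    (x : M) {y : B} (hy : y ∈ (extChartAt I x).target)
    (v : TangentSpace I ((extChartAt I x).symm y)) :
    fderivWithin ℝ (g ∘ (extChartAt I x).symm) (Set.range I) y
      ((mfderivWithin 𝓘(ℝ, B) I (extChartAt I x).symm (Set.range I) y).inverse v) =
      mvfderiv I g ((extChartAt I x).symm y) v := by
  have : IsManifold I 1 M := IsManifold.of_le (n := ∞) (by simp)
  have hinv := isInvertible_mfderivWithin_extChartAt_symm (I := I) hy
  have hc := mfderiv_comp_mfderivWithin (I := 𝓘(ℝ, B)) (I' := I) (I'' := 𝓘(ℝ, ℝ)) (g := g)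
    (f := (extChartAt I x).symm) (s := Set.range I) y (hg.mdifferentiableAt (by simp))
    (mdifferentiableWithinAt_extChartAt_symm hy)
    ((I.uniqueMDiffOn) y (extChartAt_target_subset_range x hy))
  rw [← mfderivWithin_eq_fderivWithin, hc]
  obtain ⟨e, he⟩ := hinv
  rw [← he, ContinuousLinearMap.inverse_equiv]
  change (mfderiv I 𝓘(ℝ, ℝ) g _) (e (e.symm v)) = _
  rw [e.apply_symm_apply]
  rfl

theorem mvfderiv_chart_inverse {B : Type*} [NormedAddCommGroup B] [NormedSpace ℝ B] {H : Type*}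
    [TopologicalSpace H] {I : ModelWithCorners ℝ B H} {M : Type*} [TopologicalSpace M]
    [ChartedSpace H M] [IsManifold I ∞ M] {g : M → ℝ} (hg : ContMDiff I 𝓘(ℝ, ℝ) ∞ g)
    (x : M) (w : B) :
    mvfderiv I g x ((mfderiv I 𝓘(ℝ, B) (extChartAt I x) x).inverse w) =
    fderivWithin ℝ (g ∘ (extChartAt I x).symm) (Set.range I) (extChartAt I x x) w := by
  have : IsManifold I 1 M := IsManifold.of_le (n := ∞) (by simp)
  have hxt : extChartAt I x x ∈ (extChartAt I x).target := mem_extChartAt_target x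
  have hA : MDifferentiableWithinAt 𝓘(ℝ, B) 𝓘(ℝ, ℝ) (g ∘ (extChartAt I x).symm) (Set.range I)
      (extChartAt I x x) :=
    (hg.mdifferentiableAt (by simp)).comp_mdifferentiableWithinAt _
      (mdifferentiableWithinAt_extChartAt_symm hxt)
  have hB : MDifferentiableAt I 𝓘(ℝ, B) (extChartAt I x) x :=
    mdifferentiableAt_extChartAt (mem_chart_source H x)
  have hC := (hA.hasMFDerivWithinAt).comp x (hB.hasMFDerivAt.hasMFDerivWithinAt (s := Set.univ))
    (fun y _ => by simp [extChartAt])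
  have hD : g =ᶠ[𝓝 x] (g ∘ (extChartAt I x).symm) ∘ (extChartAt I x) := by
    filter_upwards [extChartAt_source_mem_nhds (I := I) x] with y hy
    simp only [Function.comp_apply, (extChartAt I x).left_inv hy]
  have hE := ((hasMFDerivWithinAt_univ.1 hC).congr_of_eventuallyEq hD).mfderiv
  obtain ⟨e, he⟩ := isInvertible_mfderiv_extChartAt (I := I) (mem_extChartAt_source (I := I) x)
  rw [← mfderivWithin_eq_fderivWithin]
  change mfderiv I 𝓘(ℝ, ℝ) g x _ = _
  rw [hE, ← he, ContinuousLinearMap.inverse_equiv]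
  exact congrArg (mfderivWithin 𝓘(ℝ, B) 𝓘(ℝ, ℝ) (g ∘ (extChartAt I x).symm) (Set.range I)
    (extChartAt I x x)) (e.apply_symm_apply w)

theorem mvfderiv_mlieBracket {B : Type*} [NormedAddCommGroup B] [NormedSpace ℝ B] [CompleteSpace B]
    {H : Type*}
    [TopologicalSpace H] {I : ModelWithCorners ℝ B H} {M : Type*} [TopologicalSpace M]
    [ChartedSpace H M] [IsManifold I ∞ M] {f : M → ℝ} {X Y : Π x : M, TangentSpace I x}
    (hf : ContMDiff I 𝓘(ℝ, ℝ) ∞ f)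
    (hX : ContMDiff I I.tangent ∞ (fun x => (⟨x, X x⟩ : TangentBundle I M)))
    (hY : ContMDiff I I.tangent ∞ (fun x => (⟨x, Y x⟩ : TangentBundle I M))) (x : M) :
    mvfderiv I f x (mlieBracket I X Y x) =
      mvfderiv I (fun y => mvfderiv I f y (Y y)) x (X x) -
        mvfderiv I (fun y => mvfderiv I f y (X y)) x (Y x) := by
  have : IsManifold I 1 M := IsManifold.of_le (n := ∞) (by simp)
  have : IsManifold I 2 M := IsManifold.of_le (n := ∞) (WithTop.coe_le_coe.2 le_top)
  set φ := extChartAt I x with hφ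
  have hxt : φ x ∈ φ.target := mem_extChartAt_target x
  have hxr : φ x ∈ Set.range I := extChartAt_target_subset_range x hxt
  have hx0 : φ.symm (φ x) = x := extChartAt_to_inv x
  -- pulled back fields
  set X' := mpullbackWithin 𝓘(ℝ, B) I φ.symm X (Set.range I) with hX'
  set Y' := mpullbackWithin 𝓘(ℝ, B) I φ.symm Y (Set.range I) with hY'
  have key : ∀ (Z : Π x : M, TangentSpace I x) {g : M → ℝ}, ContMDiff I 𝓘(ℝ, ℝ) ∞ g →
      ∀ y ∈ φ.target, fderivWithin ℝ (g ∘ φ.symm) (Set.range I) y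
        (mpullbackWithin 𝓘(ℝ, B) I φ.symm Z (Set.range I) y) =
        mvfderiv I g (φ.symm y) (Z (φ.symm y)) := by
    intro Z g hg y hy
    exact mvfderiv_chart hg x hy _
  have ev : ∀ᶠ y in 𝓝[Set.range I] (φ x), y ∈ φ.target := extChartAt_target_mem_nhdsWithin x
  have hdX : DifferentiableWithinAt ℝ X' (Set.range I) (φ x) := by
    have := ((hX.mdifferentiable (by simp)) x).mdifferentiableWithinAt (s := Set.univ)
    have h2 := this.differentiableWithinAt_mpullbackWithin_vectorField
    rwa [Set.preimage_univ, Set.univ_inter] at h2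
  have hdY : DifferentiableWithinAt ℝ Y' (Set.range I) (φ x) := by
    have := ((hY.mdifferentiable (by simp)) x).mdifferentiableWithinAt (s := Set.univ)
    have h2 := this.differentiableWithinAt_mpullbackWithin_vectorField
    rwa [Set.preimage_univ, Set.univ_inter] at h2
  have hfc : ContDiffWithinAt ℝ 2 (f ∘ φ.symm) (Set.range I) (φ x) := by
    have h1 : ContMDiffWithinAt 𝓘(ℝ, B) 𝓘(ℝ, ℝ) ∞ (f ∘ φ.symm) (Set.range I) (φ x) :=
      (hf.contMDiffAt).comp_contMDiffWithinAt _ (contMDiffWithinAt_extChartAt_symm_range x hxt)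
    exact h1.contDiffWithinAt.of_le (WithTop.coe_le_coe.2 le_top)
  have main := fderivWithin_apply_lieBracket (n := 2) (V := X') (W := Y') hfc (by simp)
    I.uniqueDiffOn (I.range_subset_closure_interior hxr) hxr hdY hdX
  have second : ∀ (Z Z' : Π x : M, TangentSpace I x),
      ContMDiff I I.tangent ∞ (fun x => (⟨x, Z x⟩ : TangentBundle I M)) →
      fderivWithin ℝ (fun y => fderivWithin ℝ (f ∘ φ.symm) (Set.range I) y
        (mpullbackWithin 𝓘(ℝ, B) I φ.symm Z (Set.range I) y)) (Set.range I) (φ x)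
        (mpullbackWithin 𝓘(ℝ, B) I φ.symm Z' (Set.range I) (φ x)) =
      mvfderiv I (fun y => mvfderiv I f y (Z y)) x (Z' x) := by
    intro Z Z' hZ
    have e1 : (fun y => fderivWithin ℝ (f ∘ φ.symm) (Set.range I) y
        (mpullbackWithin 𝓘(ℝ, B) I φ.symm Z (Set.range I) y)) =ᶠ[𝓝[Set.range I] (φ x)]
        (fun y => mvfderiv I f y (Z y)) ∘ φ.symm := by
      filter_upwards [ev] with y hy
      exact key Z hf y hy
    rw [e1.fderivWithin_eq (key Z hf _ hxt), key Z' (contMDiff_mvfderiv_apply hf hZ) _ hxt, hx0]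
  rw [second Y X hY, second X Y hX] at main
  rw [← main, ← mlieBracketWithin_univ, mlieBracketWithin_apply]
  rw [mvfderiv_chart_inverse hf x, Set.preimage_univ, Set.univ_inter]

end VectorFields

variable {B : Type*} [NormedAddCommGroup B] [NormedSpace ℝ B]
  {H : Type*} [TopologicalSpace H] (I : ModelWithCorners ℝ B H)
  {M : Type*} [TopologicalSpace M] [ChartedSpace H M]
  (F : Type*) [NormedAddCommGroup F] [NormedSpace ℝ F]
  (E : M → Type*) [TopologicalSpace (TotalSpace F E)]
  [∀ m, AddCommGroup (E m)] [∀ m, Module ℝ (E m)] [∀ m, TopologicalSpace (E m)]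
  [FiberBundle F E] [VectorBundle ℝ F E]

/-- `Γ(E)`, the smooth sections of `E`. -/
abbrev Sec := ContMDiffSection I F ∞ E

variable {I F E}

/-- The product `f u` of a smooth function and a smooth section. -/
def fmul (f : C^∞⟮I, M; ℝ⟯) (u : Sec I F E) : Sec I F E :=
  ⟨fun m => f m • u m, f.contMDiff.smul_section u.contMDiff⟩

variable (I F E)

/-- Evaluation of sections at a point, as a linear map `Γ(E) → E_m`. -/
def evalAt (m : M) : Sec I F E →ₗ[ℝ] E m where
  toFun u := u m
  map_add' _ _ := rfl
  map_smul' _ _ := rfl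

/-- The fibre `(𝔇E)_m` of the gauge Lie algebroid: pairs `(𝔡, x)` of an `ℝ`-linear operator
`𝔡 : Γ(E) → E_m` and a tangent vector `x ∈ T_m M` (the anchor of `𝔡`) such that
`𝔡(f u) = f(m) 𝔡(u) + x(f) u(m)`. -/
def Gauge (m : M) : Submodule ℝ ((Sec I F E →ₗ[ℝ] E m) × TangentSpace I m) where
  carrier := {δ | ∀ (f : C^∞⟮I, M; ℝ⟯) (u : Sec I F E),
    δ.1 (fmul f u) = f m • δ.1 u + mvfderiv I f m δ.2 • u m}
  zero_mem' f u := by simp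
  add_mem' {a b} ha hb f u := by
    simp only [Prod.fst_add, Prod.snd_add, LinearMap.add_apply, map_add, ha f u, hb f u]
    module
  smul_mem' c a ha f u := by
    simp only [Prod.smul_fst, Prod.smul_snd, LinearMap.smul_apply, map_smul, ha f u]
    module

variable {I F E}

/-- The operator `Γ(E) → E_m` underlying an element of `(𝔇E)_m`. -/
def gaugeOp {m : M} (δ : Gauge I F E m) : Sec I F E →ₗ[ℝ] E m := δ.1.1

/-- The anchor `α : (𝔇E)_m → T_m M`. -/
def gaugeAnchor {m : M} (δ : Gauge I F E m) : TangentSpace I m := δ.1.2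

/-- The inclusion `gl(E_m) → (𝔇E)_m`, `Φ ↦ (u ↦ Φ (u m))`, with anchor zero. -/
def gaugeOfEnd {m : M} (Φ : E m →ₗ[ℝ] E m) : Gauge I F E m :=
  ⟨(Φ ∘ₗ evalAt I F E m, 0), fun f u => by simp [evalAt, fmul]⟩

variable (I F E)

/-- The fibre `(𝔍E)_m` of the jet bundle, as the standard `E`-dual of `𝔇E`: linear maps
`ν : (𝔇E)_m → E_m` with `ν(Φ) = Φ(ν(1))` for all `Φ ∈ gl(E_m)`. The one-jet of a section `u`
at `m` is the map `𝔡 ↦ 𝔡 u`. -/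
def Jet (m : M) : Submodule ℝ (Gauge I F E m →ₗ[ℝ] E m) where
  carrier := {ν | ∀ Φ : E m →ₗ[ℝ] E m, ν (gaugeOfEnd Φ) = Φ (ν (gaugeOfEnd LinearMap.id))}
  zero_mem' Φ := by simp
  add_mem' {a b} ha hb Φ := by simp only [LinearMap.add_apply, map_add, ha Φ, hb Φ]
  smul_mem' c a ha Φ := by simp only [LinearMap.smul_apply, map_smul, ha Φ]

variable {I F E}

/-- The `E`-valued pairing `⟨μ, 𝔡⟩_E` between `(𝔍E)_m` and `(𝔇E)_m`. -/
def pairAt {m : M} (μ : Jet I F E m) (δ : Gauge I F E m) : E m := μ.1 δ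

variable (I F E)

/-- `(𝓔)_m = (𝔇E)_m ⊕ (𝔍E)_m`. -/
abbrev Omni (m : M) := Gauge I F E m × Jet I F E m

variable {I F E}

/-- The symmetric `E`-valued form
`(𝔡 + μ, 𝔯 + ν)_E = (⟨𝔡, ν⟩_E + ⟨𝔯, μ⟩_E) / 2` on `𝓔_m`. -/
def omniPairing {m : M} (X Y : Omni I F E m) : E m :=
  (1 / 2 : ℝ) • (pairAt Y.2 X.1 + pairAt X.2 Y.1)

variable [IsManifold I ∞ M]
variable (I F E)

/-- `Γ(𝔇E)`: the families `m ↦ 𝔡_m ∈ (𝔇E)_m` which are smooth, i.e. `m ↦ 𝔡_m u` is a smooth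
section of `E` for each `u ∈ Γ(E)` and `m ↦ α(𝔡_m)` is a smooth vector field. -/
def GaugeSec : Submodule ℝ (Π m : M, Gauge I F E m) where
  carrier := {d | (∀ u : Sec I F E,
      ContMDiff I (I.prod 𝓘(ℝ, F)) ∞ (fun m => (⟨m, gaugeOp (d m) u⟩ : TotalSpace F E))) ∧
    ContMDiff I I.tangent ∞ (fun m => (⟨m, gaugeAnchor (d m)⟩ : TangentBundle I M))}
  zero_mem' := ⟨fun _ => (0 : Sec I F E).contMDiff,
    (0 : ContMDiffSection I B ∞ (TangentSpace I : M → Type _)).contMDiff⟩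
  add_mem' ha hb := ⟨fun u => (ha.1 u).add_section (hb.1 u), ha.2.add_section hb.2⟩
  smul_mem' _ _ ha := ⟨fun u => (ha.1 u).const_smul_section, ha.2.const_smul_section⟩

/-- `Γ(𝔍E)`: the families `m ↦ μ_m ∈ (𝔍E)_m` which are smooth as sections of `Hom(𝔇E, E)`,
i.e. `m ↦ ⟨μ_m, 𝔡_m⟩_E` is a smooth section of `E` for each `𝔡 ∈ Γ(𝔇E)`. -/
def JetSec : Submodule ℝ (Π m : M, Jet I F E m) where
  carrier := {μ | ∀ d ∈ GaugeSec I F E,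
    ContMDiff I (I.prod 𝓘(ℝ, F)) ∞ (fun m => (⟨m, pairAt (μ m) (d m)⟩ : TotalSpace F E))}
  zero_mem' _ _ := (0 : Sec I F E).contMDiff
  add_mem' ha hb d hd := (ha d hd).add_section (hb d hd)
  smul_mem' _ _ ha d hd := (ha d hd).const_smul_section

/-- `Γ(𝓔) = Γ(𝔇E) ⊕ Γ(𝔍E)`. -/
abbrev OmniSec := GaugeSec I F E × JetSec I F E

variable {I F E}

/-- The value at `m` of a section of `𝓔`. -/
def omniAt (X : OmniSec I F E) (m : M) : Omni I F E m := (X.1.1 m, X.2.1 m)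

/-- The action of `𝔡 ∈ Γ(𝔇E)` on `Γ(E)`. -/
def act (d : GaugeSec I F E) : Sec I F E →ₗ[ℝ] Sec I F E where
  toFun u := ⟨fun m => gaugeOp (d.1 m) u, d.2.1 u⟩
  map_add' u v := ContMDiffSection.ext fun m => map_add (gaugeOp (d.1 m)) u v
  map_smul' c u := ContMDiffSection.ext fun m => map_smul (gaugeOp (d.1 m)) c u

/-- The pairing `⟨μ, 𝔡⟩_E ∈ Γ(E)` of sections. -/
def pair (μ : JetSec I F E) (d : GaugeSec I F E) : Sec I F E :=
  ⟨fun m => pairAt (μ.1 m) (d.1 m), μ.2 d.1 d.2⟩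

/-- The jet prolongation `𝕕 : Γ(E) → Γ(𝔍E)`, `⟨𝕕u, 𝔡⟩_E = 𝔡 u`. -/
def jet (u : Sec I F E) : JetSec I F E :=
  ⟨fun _ => ⟨{ toFun := fun δ => gaugeOp δ u
               map_add' := fun _ _ => rfl
               map_smul' := fun _ _ => rfl }, fun _ => rfl⟩,
    fun _ hd => hd.1 u⟩

theorem act_fmul (d : GaugeSec I F E) (f : C^∞⟮I, M; ℝ⟯) (u : Sec I F E) :
    act d (fmul f u) = fmul f (act d u) +
      fmul ⟨fun m => mvfderiv I f m (gaugeAnchor (d.1 m)),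
        contMDiff_mvfderiv_apply f.contMDiff d.2.2⟩ u :=
  ContMDiffSection.ext fun m => (d.1 m).2 f u

/-- The Lie bracket of `Γ(𝔇E)`: the commutator of operators, whose anchor is the Lie bracket of
vector fields. -/
def gaugeBracket [FiniteDimensional ℝ B] (d r : GaugeSec I F E) : GaugeSec I F E :=
  ⟨fun m => ⟨(gaugeOp (d.1 m) ∘ₗ act r - gaugeOp (r.1 m) ∘ₗ act d,
      mlieBracket I (fun p => gaugeAnchor (d.1 p)) (fun p => gaugeAnchor (r.1 p)) m), by
      intro f u
      have hd : gaugeOp (d.1 m) (fmul f (act r u)) = f m • gaugeOp (d.1 m) (act r u) +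
        mvfderiv I f m (gaugeAnchor (d.1 m)) • gaugeOp (r.1 m) u := (d.1 m).2 f (act r u)
      have hr : gaugeOp (r.1 m) (fmul f (act d u)) = f m • gaugeOp (r.1 m) (act d u) +
        mvfderiv I f m (gaugeAnchor (r.1 m)) • gaugeOp (d.1 m) u := (r.1 m).2 f (act d u)
      have hd' : gaugeOp (d.1 m) (fmul ⟨fun m => mvfderiv I f m (gaugeAnchor (r.1 m)),
          contMDiff_mvfderiv_apply f.contMDiff r.2.2⟩ u) =
        mvfderiv I f m (gaugeAnchor (r.1 m)) • gaugeOp (d.1 m) u +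
        mvfderiv I (fun m => mvfderiv I f m (gaugeAnchor (r.1 m))) m
          (gaugeAnchor (d.1 m)) • u m := (d.1 m).2 _ u
      have hr' : gaugeOp (r.1 m) (fmul ⟨fun m => mvfderiv I f m (gaugeAnchor (d.1 m)),
          contMDiff_mvfderiv_apply f.contMDiff d.2.2⟩ u) =
        mvfderiv I f m (gaugeAnchor (d.1 m)) • gaugeOp (r.1 m) u +
        mvfderiv I (fun m => mvfderiv I f m (gaugeAnchor (d.1 m))) m
          (gaugeAnchor (r.1 m)) • u m := (r.1 m).2 _ u
      have := FiniteDimensional.complete ℝ B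
      have hb := mvfderiv_mlieBracket f.contMDiff d.2.2 r.2.2 m
      change mvfderiv I f m (mlieBracket I (fun p => gaugeAnchor (d.1 p))
        (fun p => gaugeAnchor (r.1 p)) m) = _ at hb
      change gaugeOp (d.1 m) (act r (fmul f u)) - gaugeOp (r.1 m) (act d (fmul f u)) =
        f m • (gaugeOp (d.1 m) (act r u) - gaugeOp (r.1 m) (act d u)) +
        mvfderiv I f m (mlieBracket I (fun p => gaugeAnchor (d.1 p))
          (fun p => gaugeAnchor (r.1 p)) m) • u m
      rw [act_fmul, act_fmul, map_add, map_add, hd, hr, hd', hr', hb]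
      module⟩,
    ⟨fun u => (act d (act r u) - act r (act d u)).contMDiff,
      by
        have := FiniteDimensional.complete ℝ B
        have h2 : IsManifold I (minSmoothness ℝ 2) M :=
          IsManifold.of_le (n := ∞) (by
            rw [minSmoothness_of_isRCLikeNormedField]; exact WithTop.coe_le_coe.2 le_top)
        have h3 : IsManifold I (((⊤ : ℕ∞) : WithTop ℕ∞) + 1) M :=
          IsManifold.of_le (n := ∞) (by simp)
        exact ContDiff.mlieBracket_vectorField (m := ⊤) (n := ⊤) d.2.2 r.2.2 (by simp)⟩⟩

/-- `lam = 𝓛_𝔡 μ`, the Lie derivative of `μ ∈ Γ(𝔍E)` along `𝔡 ∈ Γ(𝔇E)`, characterized by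
`⟨𝓛_𝔡 μ, 𝔯⟩_E = 𝔡 ⟨μ, 𝔯⟩_E - ⟨μ, [𝔡, 𝔯]⟩_E` for all `𝔯 ∈ Γ(𝔇E)`. -/
def IsLieDerivative [FiniteDimensional ℝ B] (d : GaugeSec I F E) (μ lam : JetSec I F E) : Prop :=
  ∀ r : GaugeSec I F E, pair lam r = act d (pair μ r) - pair μ (gaugeBracket d r)

/-- `Z` is the Dorfman bracket of `X = 𝔡 + μ` and `Y = 𝔯 + ν`, i.e.
`Z = [𝔡, 𝔯] + 𝓛_𝔡 ν - 𝓛_𝔯 μ + 𝕕 ⟨μ, 𝔯⟩_E`. -/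
def IsDorfmanBracket [FiniteDimensional ℝ B] (X Y Z : OmniSec I F E) : Prop :=
  ∃ lam₁ lam₂ : JetSec I F E, IsLieDerivative X.1 Y.2 lam₁ ∧ IsLieDerivative Y.1 X.2 lam₂ ∧
    Z = (gaugeBracket X.1 Y.1, lam₁ - lam₂ + jet (pair X.2 Y.1))

/-- A family of subspaces `L_m ⊆ 𝓔_m` is a smooth subbundle: near each point it has a finite
frame of smooth sections of `𝓔`. -/
def IsSubbundle (L : Π m : M, Submodule ℝ (Omni I F E m)) : Prop :=
  ∀ m : M, ∃ (k : ℕ) (e : Fin k → OmniSec I F E), ∀ᶠ p in 𝓝 m,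
    LinearIndependent ℝ (fun i => omniAt (e i) p) ∧
      Submodule.span ℝ (Set.range fun i => omniAt (e i) p) = L p

/-- A subspace of `𝓔_m` on which the `E`-valued form vanishes. -/
def IsIsotropic {m : M} (L : Submodule ℝ (Omni I F E m)) : Prop :=
  ∀ X ∈ L, ∀ Y ∈ L, omniPairing X Y = 0

/-- Dirac structures in the omni-Lie algebroid `𝓔`: subbundles which are maximal isotropic and
whose sections are closed under the Dorfman bracket. -/
structure IsDirac [FiniteDimensional ℝ B] (L : Π m : M, Submodule ℝ (Omni I F E m)) : Prop where
  subbundle : IsSubbundle L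
  maximal_isotropic : ∀ m, Maximal IsIsotropic (L m)
  closed : ∀ X Y : OmniSec I F E, (∀ m, omniAt X m ∈ L m) → (∀ m, omniAt Y m ∈ L m) →
    ∃ Z : OmniSec I F E, IsDorfmanBracket X Y Z ∧ ∀ m, omniAt Z m ∈ L m

variable (I F E)

/-- Smooth vector bundle maps `𝔍E → 𝔇E` over the identity of `M`: fibrewise linear maps sending
smooth sections to smooth sections. -/
structure JetToGauge where
  toFun : Π m : M, Jet I F E m →ₗ[ℝ] Gauge I F E m
  smooth : ∀ μ ∈ JetSec I F E, (fun m => toFun m (μ m)) ∈ GaugeSec I F E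

/-- Lie algebroid structures on `E`: an anchor `E → TM`, which is a smooth vector bundle map over
the identity, and a real Lie algebra bracket on `Γ(E)` with the Leibniz rule. -/
@[ext]
structure LieAlgebroid where
  anchor : Π m : M, E m →ₗ[ℝ] TangentSpace I m
  smooth_anchor : ContMDiff (I.prod 𝓘(ℝ, F)) I.tangent ∞
    (fun e : TotalSpace F E => (⟨e.1, anchor e.1 e.2⟩ : TangentBundle I M))
  bracket : Sec I F E →ₗ[ℝ] Sec I F E →ₗ[ℝ] Sec I F E
  bracket_self : ∀ u, bracket u u = 0
  jacobi : ∀ u v w,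
    bracket u (bracket v w) + bracket v (bracket w u) + bracket w (bracket u v) = 0
  leibniz : ∀ (u v : Sec I F E) (f : C^∞⟮I, M; ℝ⟯) (m : M),
    bracket u (fmul f v) m = f m • bracket u v m + mvfderiv I f m (anchor m (u m)) • v m

variable {I F E}

/-- The graph `L_φ = {(φ(μ), μ)}` of a bundle map `φ : 𝔍E → 𝔇E`. -/
def JetToGauge.graph (φ : JetToGauge I F E) (m : M) : Submodule ℝ (Omni I F E m) :=
  LinearMap.range ((φ.toFun m).prod LinearMap.id)

end OmniLie

end

/-!
Isotropy of the graph of `π : 𝔍E → 𝔇E` is the skew-symmetry `⟨ν, π μ⟩ = -⟨μ, π ν⟩`, and it is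
automatically maximal because an element of `𝔇E` is determined by its pairings with the jets `𝕕u`.
Jets `𝕕u` span `𝔍E`, so a skew `π` is determined by the operation `[u, v] = π(𝕕u) v` on `Γ(E)`,
which is then skew-symmetric.

For skew `π`, pairing the closure condition with `π(𝕕w)` turns it into the identity
`⟨ν, [π μ, π(𝕕w)]⟩ - ⟨μ, [π ν, π(𝕕w)]⟩ = π(𝕕w) ⟨μ, π ν⟩`. For `μ = 𝕕u` and `ν = 𝕕v` this is the
Jacobi identity of `[·, ·]`. Conversely, the Jacobi identity makes `π` invariant under every
`π(𝕕w) = [w, ·]`, which gives the identity for all `μ` and `ν`.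

The anchor of `π(𝕕u)` has to depend on `u` only through its value at the point. Expanding
`[f u, g v]` by the Leibniz rule in the two possible orders yields
`df(α(g v) - g α(v)) u + dg(α(f u) - f α(u)) v = 0`, where `α(u)` is the anchor of `π(𝕕u)`; in
rank at least two, `u` and `v` can be chosen independent at the point, and both terms vanish.
-/

noncomputable section

namespace OmniLie

variable {B : Type*} [NormedAddCommGroup B] [NormedSpace ℝ B]
  {H : Type*} [TopologicalSpace H] {I : ModelWithCorners ℝ B H}
  {M : Type*} [TopologicalSpace M] [ChartedSpace H M]
  {F : Type*} [NormedAddCommGroup F] [NormedSpace ℝ F]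
  {E : M → Type*} [TopologicalSpace (TotalSpace F E)]
  [∀ m, AddCommGroup (E m)] [∀ m, Module ℝ (E m)] [∀ m, TopologicalSpace (E m)]
  [FiberBundle F E] [VectorBundle ℝ F E]
  {ι κ : Type*} [Fintype ι] [DecidableEq ι] [Fintype κ] [DecidableEq κ]

section LocalFrames

theorem exists_bump [IsManifold I ∞ M] [FiniteDimensional ℝ B] [T2Space M] {m : M} {s : Set M}
    (hs : s ∈ 𝓝 m) : ∃ χ : C^∞⟮I, M; ℝ⟯, (∀ᶠ p in 𝓝 m, χ p = 1) ∧ tsupport χ ⊆ s := by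
  obtain ⟨f, -, hf⟩ := (SmoothBumpFunction.nhds_basis_tsupport (I := I) m).mem_iff.1 hs
  exact ⟨⟨f, f.contMDiff⟩, f.eventuallyEq_one, hf⟩

variable (I F E ι) in
/-- Sections of `E` which form a frame over an open set `dom`, together with the dual frame.
All of them are defined and smooth on the whole of `M`, but carry no information off `dom`. -/
structure LocalFrame where
  dom : Set M
  isOpen_dom : IsOpen dom
  sec : ι → Sec I F E
  coeff : ι → Π p : M, E p →ₗ[ℝ] ℝ
  contMDiff_coeff : ∀ i, ContMDiff (I.prod 𝓘(ℝ, F)) 𝓘(ℝ, ℝ) ∞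
    (fun v : TotalSpace F E => coeff i v.1 v.2)
  coeff_sec : ∀ p ∈ dom, ∀ i j, coeff i p (sec j p) = if i = j then 1 else 0
  sum_coeff_smul_sec : ∀ p ∈ dom, ∀ v : E p, ∑ i, coeff i p v • sec i p = v

theorem contMDiffOn_clm_linearMapAt [ContMDiffVectorBundle ∞ F E I] {V : Type*}
    [NormedAddCommGroup V] [NormedSpace ℝ V] (t : Trivialization F (TotalSpace.proj (E := E)))
    [MemTrivializationAtlas t] (c : F →L[ℝ] V) :
    ContMDiffOn (I.prod 𝓘(ℝ, F)) 𝓘(ℝ, V) ∞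
      (fun v : TotalSpace F E => c (t.linearMapAt ℝ v.1 v.2)) t.source := by
  refine (c.contMDiff.comp_contMDiffOn (contMDiff_snd.comp_contMDiffOn
    (t.contMDiffOn (IB := I) (n := ∞)))).congr fun v hv => ?_
  simp only [t.coe_linearMapAt_of_mem (t.mem_source.1 hv), Function.comp_apply]

/-- The local frame given by a trivialization and a basis of the model fibre, extended to `M` by
means of a cutoff function. -/
def LocalFrame.ofTrivialization [FiniteDimensional ℝ F] [ContMDiffVectorBundle ∞ F E I]
    (t : Trivialization F (TotalSpace.proj (E := E))) [MemTrivializationAtlas t]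
    (b : Module.Basis ι ℝ F) (χ : C^∞⟮I, M; ℝ⟯) (hχ : tsupport χ ⊆ t.baseSet) :
    LocalFrame I F E ι where
  dom := interior {p | χ p = 1}
  isOpen_dom := isOpen_interior
  sec i := ⟨fun p => χ p • t.localFrame b i p,
    ContMDiffOn.smul_section_of_tsupport χ.contMDiff.contMDiffOn t.open_baseSet hχ
      (t.contMDiffOn_localFrame_baseSet ∞ b i)⟩
  coeff i p := χ p • (b.coord i ∘ₗ t.linearMapAt ℝ p)
  contMDiff_coeff i := by
    refine contMDiff_of_tsupport fun v hv => ?_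
    have hv' : v ∈ t.source := t.mem_source.2 <| hχ <|
      tsupport_comp_subset_preimage (χ : M → ℝ) (FiberBundle.continuous_proj F E) <|
        tsupport_smul_subset_left (fun v : TotalSpace F E => χ v.1)
          (fun v => b.coord i (t.linearMapAt ℝ v.1 v.2)) hv
    exact (χ.contMDiff.contMDiffAt.comp v (Bundle.contMDiff_proj E).contMDiffAt).smul
      ((contMDiffOn_clm_linearMapAt t (LinearMap.toContinuousLinearMap (b.coord i))).contMDiffAt
        (t.open_source.mem_nhds hv'))
  coeff_sec p hp i j := by
    have hχp : χ p = 1 := interior_subset (s := {p | χ p = 1}) hp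
    have hpt : p ∈ t.baseSet := hχ (subset_tsupport _ (by simp [hχp]))
    change χ p • b.coord i (t.linearMapAt ℝ p (χ p • t.localFrame b j p)) = _
    rw [hχp, one_smul, one_smul, t.localFrame_apply_of_mem_baseSet b hpt]
    simp [Trivialization.basisAt, Finsupp.single_apply, eq_comm, hpt]
  sum_coeff_smul_sec p hp v := by
    have hχp : χ p = 1 := interior_subset (s := {p | χ p = 1}) hp
    have hpt : p ∈ t.baseSet := hχ (subset_tsupport _ (by simp [hχp]))
    change ∑ i, (χ p • b.coord i (t.linearMapAt ℝ p v)) • χ p • t.localFrame b i p = v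
    simp only [hχp, one_smul, t.localFrame_apply_of_mem_baseSet b hpt]
    convert (t.basisAt b hpt).sum_repr v using 3
    simp [Trivialization.basisAt, hpt]

/-- The coefficients of a section with respect to a local frame. -/
def LocalFrame.coeffFun (e : LocalFrame I F E ι) (i : ι) (u : Sec I F E) : C^∞⟮I, M; ℝ⟯ :=
  ⟨fun p => e.coeff i p (u p), (e.contMDiff_coeff i).comp u.contMDiff⟩

theorem mvfderiv_clm_extChartAt [IsManifold I ∞ M] {m p : M} (hp : p ∈ (chartAt H m).source)
    (c : B →L[ℝ] ℝ) (v : TangentSpace I p) :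
    mvfderiv I (fun q => c (extChartAt I m q)) p v =
      c ((trivializationAt B (TangentSpace I : M → Type _) m).linearMapAt ℝ p v) := by
  have : IsManifold I 1 M := IsManifold.of_le (n := ∞) (by simp)
  have h : HasMFDerivAt I 𝓘(ℝ, ℝ) (c ∘ extChartAt I m) p
      (c ∘L mfderiv I 𝓘(ℝ, B) (extChartAt I m) p) :=
    c.hasMFDerivAt.comp p (mdifferentiableAt_extChartAt hp).hasMFDerivAt
  rw [mvfderiv, show (fun q => c (extChartAt I m q)) = c ∘ extChartAt I m from rfl, h.mfderiv,
    ← TangentBundle.continuousLinearMapAt_trivializationAt hp]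
  rfl

variable [IsManifold I ∞ M] [FiniteDimensional ℝ B] [T2Space M]

theorem exists_localFrame [FiniteDimensional ℝ F] [ContMDiffVectorBundle ∞ F E I] (m : M) :
    ∃ e : LocalFrame I F E (Fin (Module.finrank ℝ F)), m ∈ e.dom := by
  obtain ⟨χ, hχ, hχt⟩ := exists_bump (I := I) <|
    (trivializationAt F E m).open_baseSet.mem_nhds (mem_baseSet_trivializationAt F E m)
  exact ⟨.ofTrivialization (trivializationAt F E m) (Module.finBasis ℝ F) χ hχt,
    mem_interior_iff_mem_nhds.2 hχ⟩

variable (I M κ) in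
/-- Smooth functions which are coordinates over an open set `dom`, together with the coordinate
vector fields. -/
structure LocalCoordinates extends LocalFrame I B (TangentSpace I : M → Type _) κ where
  coord : κ → C^∞⟮I, M; ℝ⟯
  mvfderiv_coord : ∀ p ∈ dom, ∀ k (v : TangentSpace I p), mvfderiv I (coord k) p v = coeff k p v

theorem exists_localCoordinates (m : M) :
    ∃ x : LocalCoordinates I M (Fin (Module.finrank ℝ B)), m ∈ x.dom := by
  set t := trivializationAt B (TangentSpace I : M → Type _) m
  obtain ⟨χ, hχ, hχt⟩ := exists_bump (I := I) (m := m) <|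
    t.open_baseSet.mem_nhds (mem_baseSet_trivializationAt B (TangentSpace I : M → Type _) m)
  let c k : B →L[ℝ] ℝ := LinearMap.toContinuousLinearMap ((Module.finBasis ℝ B).coord k)
  refine ⟨{ LocalFrame.ofTrivialization t (Module.finBasis ℝ B) χ hχt with
    coord := fun k => ⟨fun p => χ p • c k (extChartAt I m p), ?_⟩
    mvfderiv_coord := fun p hp k v => ?_ }, mem_interior_iff_mem_nhds.2 hχ⟩
  · refine contMDiff_of_tsupport fun p hp => ?_
    have hpt : p ∈ t.baseSet := hχt (tsupport_smul_subset_left (χ : M → ℝ) _ hp)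
    exact χ.contMDiff.contMDiffAt.smul
      ((c k).contMDiff.contMDiffAt.comp p (contMDiffAt_extChartAt' hpt))
  · have hχp : ∀ᶠ q in 𝓝 p, χ q = 1 := mem_interior_iff_mem_nhds.1 hp
    have hpt : p ∈ t.baseSet := hχt (subset_tsupport _ (by simp [hχp.self_of_nhds]))
    have h : (fun q => χ q • c k (extChartAt I m q)) =ᶠ[𝓝 p] fun q => c k (extChartAt I m q) := by
      filter_upwards [hχp] with q hq
      rw [hq, one_smul]
    change mfderiv I 𝓘(ℝ, ℝ) (fun q => χ q • c k (extChartAt I m q)) p v =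
      χ p • c k (t.linearMapAt ℝ p v)
    rw [h.mfderiv_eq, hχp.self_of_nhds]
    exact (mvfderiv_clm_extChartAt hpt (c k) v).trans (one_smul ℝ _).symm

theorem tangent_ext {m : M} {v w : TangentSpace I m}
    (h : ∀ f : C^∞⟮I, M; ℝ⟯, mvfderiv I f m v = mvfderiv I f m w) : v = w := by
  obtain ⟨x, hx⟩ := exists_localCoordinates (I := I) m
  rw [← x.sum_coeff_smul_sec m hx v, ← x.sum_coeff_smul_sec m hx w]
  simp only [← x.mvfderiv_coord m hx, h]

theorem exists_sec_eq [FiniteDimensional ℝ F] [ContMDiffVectorBundle ∞ F E I] {m : M} (v : E m) :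
    ∃ u : Sec I F E, u m = v := by
  obtain ⟨e, he⟩ := exists_localFrame (I := I) (F := F) (E := E) m
  refine ⟨∑ i, e.coeff i m v • e.sec i, ?_⟩
  change evalAt I F E m _ = v
  rw [map_sum]
  exact e.sum_coeff_smul_sec m he v

theorem LocalFrame.eq_sum_of_tensorial (e : LocalFrame I F E ι) {W : Type*} [AddCommGroup W]
    [Module ℝ W] {p : M} (hp : p ∈ e.dom) (T : Sec I F E →ₗ[ℝ] W)
    (hT : ∀ f u, T (fmul f u) = f p • T u) (u : Sec I F E) :
    T u = ∑ i, e.coeff i p (u p) • T (e.sec i) := by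
  obtain ⟨χ, hχ, hχU⟩ := exists_bump (I := I) (e.isOpen_dom.mem_nhds hp)
  have h : fmul χ u = ∑ i, fmul χ (fmul (e.coeffFun i u) (e.sec i)) := by
    refine ContMDiffSection.ext fun q => ?_
    change χ q • u q = evalAt I F E q (∑ i, fmul χ (fmul (e.coeffFun i u) (e.sec i)))
    rw [map_sum]
    change χ q • u q = ∑ i, χ q • e.coeff i q (u q) • e.sec i q
    rw [← Finset.smul_sum]
    by_cases hq : q ∈ e.dom
    · rw [e.sum_coeff_smul_sec q hq]
    · rw [image_eq_zero_of_notMem_tsupport fun h' => hq (hχU h'), zero_smul, zero_smul]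
  have hT' := congrArg T h
  simp only [map_sum, hT, hχ.self_of_nhds, one_smul] at hT'
  exact hT'

theorem exists_linearMap_of_tensorial [FiniteDimensional ℝ F] [ContMDiffVectorBundle ∞ F E I]
    {W : Type*} [AddCommGroup W] [Module ℝ W] {m : M} (T : Sec I F E →ₗ[ℝ] W)
    (hT : ∀ f u, T (fmul f u) = f m • T u) : ∃ a : E m →ₗ[ℝ] W, ∀ u, T u = a (u m) := by
  obtain ⟨e, he⟩ := exists_localFrame (I := I) (F := F) (E := E) m
  refine ⟨∑ i, (e.coeff i m).smulRight (T (e.sec i)), fun u => ?_⟩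
  rw [LinearMap.sum_apply]
  exact e.eq_sum_of_tensorial he T hT u

theorem contMDiff_totalSpace_of_sec [FiniteDimensional ℝ F] [ContMDiffVectorBundle ∞ F E I]
    {V : Type*} [NormedAddCommGroup V] [NormedSpace ℝ V] {G : M → Type*}
    [TopologicalSpace (TotalSpace V G)] [∀ m, AddCommGroup (G m)] [∀ m, Module ℝ (G m)]
    [∀ m, TopologicalSpace (G m)] [FiberBundle V G] [VectorBundle ℝ V G]
    (a : Π m : M, E m →ₗ[ℝ] G m)
    (ha : ∀ u : Sec I F E,
      ContMDiff I (I.prod 𝓘(ℝ, V)) ∞ (fun m => (⟨m, a m (u m)⟩ : TotalSpace V G))) :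
    ContMDiff (I.prod 𝓘(ℝ, F)) (I.prod 𝓘(ℝ, V)) ∞
      (fun v : TotalSpace F E => (⟨v.1, a v.1 v.2⟩ : TotalSpace V G)) := by
  intro v
  obtain ⟨e, he⟩ := exists_localFrame (I := I) (F := F) (E := E) v.1
  set t := trivializationAt V G v.1
  have hproj : ContMDiff (I.prod 𝓘(ℝ, F)) I ∞ (TotalSpace.proj : TotalSpace F E → M) :=
    Bundle.contMDiff_proj E
  have hterm : ∀ i, ContMDiffAt (I.prod 𝓘(ℝ, F)) 𝓘(ℝ, V) ∞ (fun w : TotalSpace F E =>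
      e.coeff i w.1 w.2 • (t ⟨w.1, a w.1 (e.sec i w.1)⟩).2) v := fun i =>
    (e.contMDiff_coeff i).contMDiffAt.smul
      (Bundle.contMDiffAt_totalSpace.1 ((ha (e.sec i)).comp hproj).contMDiffAt).2
  refine Bundle.contMDiffAt_totalSpace.2 ⟨hproj.contMDiffAt,
    (ContMDiffAt.sum (t := Finset.univ) fun i _ => hterm i).congr_of_eventuallyEq ?_⟩
  filter_upwards [hproj.continuous.continuousAt.preimage_mem_nhds
      (t.open_baseSet.mem_nhds (mem_baseSet_trivializationAt V G v.1)),
    hproj.continuous.continuousAt.preimage_mem_nhds (e.isOpen_dom.mem_nhds he)] with w hwt hwe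
  have ht : ∀ x : G w.1, (t ⟨w.1, x⟩).2 = t.linearMapAt ℝ w.1 x := fun x => by
    rw [t.coe_linearMapAt_of_mem hwt]
  have haw : a w.1 w.2 = ∑ i, e.coeff i w.1 w.2 • a w.1 (e.sec i w.1) := by
    simp only [← map_smul, ← map_sum, e.sum_coeff_smul_sec w.1 hwe w.2]
  change (t ⟨w.1, a w.1 w.2⟩).2 = ∑ i, _
  simp only [ht, haw, map_sum, map_smul]

end LocalFrames

section GaugeFibre

variable {m : M}

theorem gaugeOp_fmul (δ : Gauge I F E m) (f : C^∞⟮I, M; ℝ⟯) (u : Sec I F E) :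
    gaugeOp δ (fmul f u) = f m • gaugeOp δ u + mvfderiv I f m (gaugeAnchor δ) • u m :=
  δ.2 f u

theorem gauge_ext {δ δ' : Gauge I F E m} (hop : ∀ u, gaugeOp δ u = gaugeOp δ' u)
    (hanchor : gaugeAnchor δ = gaugeAnchor δ') : δ = δ' :=
  Subtype.ext (Prod.ext (LinearMap.ext hop) hanchor)

/-- Evaluation of jets at `δ`, i.e. the pairing `⟨·, δ⟩_E` as a linear map. -/
def jetEval (δ : Gauge I F E m) : Jet I F E m →ₗ[ℝ] E m :=
  LinearMap.applyₗ δ ∘ₗ (Jet I F E m).subtype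

end GaugeFibre

namespace LocalFrame

variable (e : LocalFrame I F E ι) {p : M}

/-- The covariant derivative for which the frame is parallel. -/
def flatDeriv (p : M) (v : TangentSpace I p) : Sec I F E →ₗ[ℝ] E p where
  toFun u := ∑ i, mvfderiv I (e.coeffFun i u) p v • e.sec i p
  map_add' u w := by
    rw [← Finset.sum_add_distrib]
    refine Finset.sum_congr rfl fun i _ => ?_
    rw [show ⇑(e.coeffFun i (u + w)) = fun q => e.coeffFun i u q + e.coeffFun i w q from
        funext fun q => map_add (e.coeff i q) (u q) (w q),
      mvfderiv_fun_add ((e.coeffFun i u).contMDiff.mdifferentiableAt (by simp))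
        ((e.coeffFun i w).contMDiff.mdifferentiableAt (by simp)), add_apply, add_smul]
  map_smul' c u := by
    rw [Finset.smul_sum]
    refine Finset.sum_congr rfl fun i _ => ?_
    rw [show ⇑(e.coeffFun i (c • u)) = fun q => c * e.coeffFun i u q from
        funext fun q => map_smul (e.coeff i q) c (u q),
      mvfderiv_fun_mul mdifferentiableAt_const
        ((e.coeffFun i u).contMDiff.mdifferentiableAt (by simp)), mvfderiv_const]
    simp only [smul_zero, add_zero, FunLike.coe_smul, Pi.smul_apply, smul_eq_mul, mul_smul,
      RingHom.id_apply]

theorem flatDeriv_fmul (v : TangentSpace I p) (f : C^∞⟮I, M; ℝ⟯) (u : Sec I F E) :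
    e.flatDeriv p v (fmul f u) =
      f p • e.flatDeriv p v u + mvfderiv I f p v • ∑ i, e.coeff i p (u p) • e.sec i p := by
  have hcoeff : ∀ i, mvfderiv I (e.coeffFun i (fmul f u)) p v =
      f p * mvfderiv I (e.coeffFun i u) p v + mvfderiv I f p v * e.coeff i p (u p) := fun i => by
    rw [show ⇑(e.coeffFun i (fmul f u)) = fun q => f q * e.coeffFun i u q from
        funext fun q => map_smul (e.coeff i q) (f q) (u q),
      mvfderiv_fun_mul (f.contMDiff.mdifferentiableAt (by simp))
        ((e.coeffFun i u).contMDiff.mdifferentiableAt (by simp)), mul_comm (mvfderiv I f p v)]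
    rfl
  change ∑ i, mvfderiv I (e.coeffFun i (fmul f u)) p v • e.sec i p =
    f p • ∑ i, mvfderiv I (e.coeffFun i u) p v • e.sec i p + _
  simp only [hcoeff, add_smul, mul_smul, Finset.sum_add_distrib, Finset.smul_sum]

theorem flatDeriv_sec (hp : p ∈ e.dom) (v : TangentSpace I p) (i : ι) :
    e.flatDeriv p v (e.sec i) = 0 := by
  refine Finset.sum_eq_zero fun j _ => ?_
  have h : ⇑(e.coeffFun j (e.sec i)) =ᶠ[𝓝 p] fun _ => if j = i then (1 : ℝ) else 0 := by
    filter_upwards [e.isOpen_dom.mem_nhds hp] with q hq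
    exact e.coeff_sec q hq j i
  have h' : mvfderiv I (e.coeffFun j (e.sec i)) p v = 0 := by
    change mfderiv I 𝓘(ℝ, ℝ) (e.coeffFun j (e.sec i)) p v = 0
    rw [h.mfderiv_eq, mfderiv_const]
    rfl
  rw [h', zero_smul]

/-- The lift of tangent vectors to `𝔇E` by the covariant derivative for which the frame is
parallel. -/
def lift (hp : p ∈ e.dom) : TangentSpace I p →ₗ[ℝ] Gauge I F E p where
  toFun v := ⟨(e.flatDeriv p v, v), fun f u => by
    rw [e.flatDeriv_fmul, e.sum_coeff_smul_sec p hp]⟩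
  map_add' v w := gauge_ext (fun u => by
    change ∑ i, mvfderiv I (e.coeffFun i u) p (v + w) • e.sec i p = ∑ i, _ + ∑ i, _
    simp only [map_add, add_smul, Finset.sum_add_distrib]) rfl
  map_smul' c v := gauge_ext (fun u => by
    change ∑ i, mvfderiv I (e.coeffFun i u) p (c • v) • e.sec i p = c • ∑ i, _
    simp only [map_smul, smul_assoc, Finset.smul_sum]) rfl

theorem gaugeOp_lift_sec (hp : p ∈ e.dom) (v : TangentSpace I p) (i : ι) :
    gaugeOp (e.lift hp v) (e.sec i) = 0 :=
  e.flatDeriv_sec hp v i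

variable [IsManifold I ∞ M]

/-- The lift to `𝔇E` of a vector field vanishing off the domain of the frame. -/
def liftSec (X : Sec I B (TangentSpace I : M → Type _)) (hX : ∀ p ∉ e.dom, X p = 0) :
    GaugeSec I F E :=
  ⟨fun p => ⟨(e.flatDeriv p (X p), X p), fun f u => by
      rw [e.flatDeriv_fmul]
      by_cases hp : p ∈ e.dom
      · rw [e.sum_coeff_smul_sec p hp]
      · rw [hX p hp, map_zero, zero_smul, zero_smul]⟩,
    fun u => ContMDiff.sum_section fun i _ =>
      (contMDiff_mvfderiv_apply (e.coeffFun i u).contMDiff X.contMDiff).smul_section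
        (e.sec i).contMDiff, X.contMDiff⟩

theorem eq_gaugeOfEnd_add_lift [FiniteDimensional ℝ B] [T2Space M] (hp : p ∈ e.dom)
    (δ : Gauge I F E p) :
    δ = gaugeOfEnd (∑ i, (e.coeff i p).smulRight (gaugeOp δ (e.sec i))) +
      e.lift hp (gaugeAnchor δ) := by
  rw [← sub_eq_iff_eq_add]
  set Φ := δ - e.lift hp (gaugeAnchor δ)
  have hanchor : gaugeAnchor Φ = 0 := sub_self (gaugeAnchor δ)
  have hsec : ∀ i, gaugeOp Φ (e.sec i) = gaugeOp δ (e.sec i) := fun i =>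
    (congrArg (gaugeOp δ (e.sec i) - ·) (e.gaugeOp_lift_sec hp (gaugeAnchor δ) i)).trans
      (sub_zero _)
  refine gauge_ext (fun u => ?_) hanchor
  rw [e.eq_sum_of_tensorial hp (gaugeOp Φ) (fun f v => by
    rw [gaugeOp_fmul, hanchor, map_zero, zero_smul, add_zero]) u]
  change _ = (∑ i, (e.coeff i p).smulRight (gaugeOp δ (e.sec i))) (u p)
  simp only [hsec, LinearMap.sum_apply, LinearMap.smulRight_apply]

end LocalFrame

section Jets

variable [IsManifold I ∞ M] {m p : M}

variable (I F E) in
/-- The identity of `E`, as a section of `𝔇E` with anchor zero. -/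
def gaugeOne : GaugeSec I F E :=
  ⟨fun _ => gaugeOfEnd LinearMap.id, fun u => u.contMDiff,
    (0 : ContMDiffSection I B ∞ (TangentSpace I : M → Type _)).contMDiff⟩

/-- The product `f μ` of a smooth function and a section of `𝔍E`. -/
def jetFmul (f : C^∞⟮I, M; ℝ⟯) (μ : JetSec I F E) : JetSec I F E :=
  ⟨fun m => f m • μ.1 m, fun d hd => f.contMDiff.smul_section (μ.2 d hd)⟩

/-- The section `df ⊗ u` of `𝔍E`, in the image of `T*M ⊗ E → 𝔍E`. -/
def differentialTensor (f : C^∞⟮I, M; ℝ⟯) (u : Sec I F E) : JetSec I F E :=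
  jet (fmul f u) - jetFmul f (jet u)

theorem differentialTensor_apply (f : C^∞⟮I, M; ℝ⟯) (u : Sec I F E) (δ : Gauge I F E m) :
    ((differentialTensor f u).1 m).1 δ = mvfderiv I f m (gaugeAnchor δ) • u m :=
  sub_eq_of_eq_add' (gaugeOp_fmul δ f u)

variable (e : LocalFrame I F E ι) (x : LocalCoordinates I M κ)

/-- The sections `𝕕eᵢ` and `dxₖ ⊗ eᵢ`, which are a frame of `𝔍E` over `e.dom ∩ x.dom`. -/
def jetFrame : ι ⊕ κ × ι → JetSec I F E :=
  Sum.elim (fun i => jet (e.sec i)) fun k => differentialTensor (x.coord k.1) (e.sec k.2)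

/-- The frame of the dual of `𝔍E` which is dual to `jetFrame`. -/
def jetCoeff (he : p ∈ e.dom) : ι ⊕ κ × ι → Module.Dual ℝ (Jet I F E p) :=
  Sum.elim (fun i => e.coeff i p ∘ₗ jetEval ((gaugeOne I F E).1 p))
    fun k => e.coeff k.2 p ∘ₗ jetEval (e.lift he (x.sec k.1 p))

theorem jetCoeff_jetFrame (he : p ∈ e.dom) (hx : p ∈ x.dom) (a b : ι ⊕ κ × ι) :
    jetCoeff e x he a ((jetFrame e x b).1 p) = if a = b then 1 else 0 := by
  rcases a with i | ⟨k, i⟩ <;> rcases b with j | ⟨l, j⟩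
  · exact (e.coeff_sec p he i j).trans (by simp only [Sum.inl.injEq])
  · change e.coeff i p (((differentialTensor (x.coord l) (e.sec j)).1 p).1 _) = 0
    rw [differentialTensor_apply]
    change e.coeff i p (mvfderiv I (x.coord l) p 0 • _) = 0
    rw [map_zero, zero_smul, map_zero]
  · exact (congrArg (e.coeff i p) (e.gaugeOp_lift_sec he _ j)).trans (map_zero _)
  · change e.coeff i p (((differentialTensor (x.coord l) (e.sec j)).1 p).1 _) = _
    rw [differentialTensor_apply, map_smul, e.coeff_sec p he]
    change mvfderiv I (x.coord l) p (x.sec k p) • _ = _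
    rw [x.mvfderiv_coord p hx, x.coeff_sec p hx]
    simp [← ite_and, and_comm, eq_comm]

theorem linearIndependent_jetFrame (he : p ∈ e.dom) (hx : p ∈ x.dom) :
    LinearIndependent ℝ fun a => (jetFrame e x a).1 p :=
  .of_pairwise_dual_eq_zero_one _ (jetCoeff e x he)
    (fun a b hab => (jetCoeff_jetFrame e x he hx a b).trans (if_neg hab))
    fun a => (jetCoeff_jetFrame e x he hx a a).trans (if_pos rfl)

theorem sum_jetCoeff_smul_jetFrame [FiniteDimensional ℝ B] [T2Space M] (he : p ∈ e.dom)
    (hx : p ∈ x.dom) (ν : Jet I F E p) : ∑ a, jetCoeff e x he a ν • (jetFrame e x a).1 p = ν := by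
  refine Subtype.ext (LinearMap.ext fun δ => ?_)
  have hvertical : ν.1 (gaugeOfEnd (∑ i, (e.coeff i p).smulRight (gaugeOp δ (e.sec i)))) =
      ∑ i, e.coeff i p (ν.1 ((gaugeOne I F E).1 p)) • gaugeOp δ (e.sec i) := by
    rw [ν.2, LinearMap.sum_apply]
    rfl
  have hhorizontal : ν.1 (e.lift he (gaugeAnchor δ)) =
      ∑ k, ∑ i, e.coeff i p (ν.1 (e.lift he (x.sec k p))) •
        mvfderiv I (x.coord k) p (gaugeAnchor δ) • e.sec i p := by
    conv_lhs => rw [← x.sum_coeff_smul_sec p hx (gaugeAnchor δ)]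
    simp only [map_sum, map_smul]
    refine Finset.sum_congr rfl fun k _ => ?_
    conv_lhs => rw [← e.sum_coeff_smul_sec p he (ν.1 _), Finset.smul_sum]
    simp only [x.mvfderiv_coord p hx, smul_comm (x.coeff k p (gaugeAnchor δ))]
  conv_rhs => rw [e.eq_gaugeOfEnd_add_lift he δ, map_add, hvertical, hhorizontal]
  rw [Fintype.sum_sum_type, Fintype.sum_prod_type]
  simp only [Submodule.coe_add, Submodule.coe_sum, Submodule.coe_smul, LinearMap.add_apply,
    LinearMap.sum_apply, LinearMap.smul_apply, jetFrame, Sum.elim_inl, Sum.elim_inr,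
    differentialTensor_apply]
  rfl

variable [FiniteDimensional ℝ B] [T2Space M]

theorem span_jetFrame (he : p ∈ e.dom) (hx : p ∈ x.dom) :
    Submodule.span ℝ (Set.range fun a => (jetFrame e x a).1 p) = ⊤ := by
  refine eq_top_iff.2 fun ν _ => ?_
  rw [← sum_jetCoeff_smul_jetFrame e x he hx ν]
  exact sum_mem fun a _ => Submodule.smul_mem _ _ (Submodule.subset_span ⟨a, rfl⟩)

theorem exists_jetFmul_eq_sum (he : m ∈ e.dom) (hx : m ∈ x.dom) (μ : JetSec I F E) :
    ∃ (χ : C^∞⟮I, M; ℝ⟯) (f : ι ⊕ κ × ι → C^∞⟮I, M; ℝ⟯), χ m = 1 ∧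
      jetFmul χ μ = ∑ a, jetFmul (f a) (jetFrame e x a) := by
  obtain ⟨χ, hχm, hχ⟩ := exists_bump (I := I) <|
    Filter.inter_mem (e.isOpen_dom.mem_nhds he) (x.isOpen_dom.mem_nhds hx)
  have hχ0 : ∀ p, p ∉ e.dom ∩ x.dom → χ p = 0 := fun p hp =>
    image_eq_zero_of_notMem_tsupport fun h => hp (hχ h)
  have hX : ∀ k, ∀ p ∉ e.dom, fmul χ (x.sec k) p = 0 := fun k p hp => by
    change χ p • x.sec k p = 0
    rw [hχ0 p fun h => hp h.1, zero_smul]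
  let g : ι ⊕ κ × ι → C^∞⟮I, M; ℝ⟯ :=
    Sum.elim (fun i => χ * e.coeffFun i (pair μ (gaugeOne I F E)))
      fun k => e.coeffFun k.2 (pair μ (e.liftSec (fmul χ (x.sec k.1)) (hX k.1)))
  have hg : ∀ p (hp : p ∈ e.dom) a, g a p = χ p * jetCoeff e x hp a (μ.1 p) := by
    rintro p hp (i | ⟨k, i⟩)
    · rfl
    · change e.coeff i p ((μ.1 p).1 (e.lift hp (χ p • x.sec k p))) = _
      rw [map_smul, map_smul, map_smul]
      rfl
  refine ⟨χ * χ, fun a => χ * g a, ?_, Subtype.ext (funext fun p => ?_)⟩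
  · change χ m * χ m = 1
    rw [hχm.self_of_nhds, one_mul]
  · rw [Submodule.coe_sum, Finset.sum_apply]
    change (χ p * χ p) • μ.1 p = ∑ a, (χ p * g a p) • (jetFrame e x a).1 p
    by_cases hp : p ∈ e.dom ∩ x.dom
    · simp only [hg p hp.1, ← mul_assoc, mul_smul _ (jetCoeff e x hp.1 _ _), ← Finset.smul_sum,
        sum_jetCoeff_smul_jetFrame e x hp.1 hp.2]
    · simp only [hχ0 p hp, zero_mul, zero_smul, Finset.sum_const_zero]

variable [FiniteDimensional ℝ F] [ContMDiffVectorBundle ∞ F E I]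

variable (I F E) in
/-- The one-jet at a point, as a linear map on sections. -/
def jetAt (m : M) : Sec I F E →ₗ[ℝ] Jet I F E m where
  toFun u := (jet u).1 m
  map_add' u v := Subtype.ext <| LinearMap.ext fun δ => map_add (gaugeOp δ) u v
  map_smul' c u := Subtype.ext <| LinearMap.ext fun δ => map_smul (gaugeOp δ) c u

theorem exists_jetAt_eq (ν : Jet I F E m) : ∃ u, jetAt I F E m u = ν := by
  obtain ⟨e, he⟩ := exists_localFrame (I := I) (F := F) (E := E) m
  obtain ⟨x, hx⟩ := exists_localCoordinates (I := I) m
  change ν ∈ LinearMap.range (jetAt I F E m)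
  rw [← sum_jetCoeff_smul_jetFrame e x he hx ν]
  refine sum_mem fun a _ => Submodule.smul_mem _ _ ?_
  rcases a with i | ⟨k, i⟩
  · exact ⟨e.sec i, rfl⟩
  · refine ⟨fmul (x.coord k) (e.sec i) - x.coord k m • e.sec i, ?_⟩
    rw [map_sub, map_smul]
    rfl

theorem jetSec_induction {P : JetSec I F E → Prop} (jet : ∀ u, P (jet u))
    (add : ∀ μ ν, P μ → P ν → P (μ + ν)) (jetFmul : ∀ f μ, P μ → P (jetFmul f μ))
    (of_jetFmul : ∀ χ μ, χ m = 1 → P (OmniLie.jetFmul χ μ) → P μ) (μ : JetSec I F E) : P μ := by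
  obtain ⟨e, he⟩ := exists_localFrame (I := I) (F := F) (E := E) m
  obtain ⟨x, hx⟩ := exists_localCoordinates (I := I) m
  obtain ⟨χ, f, hχ, hμ⟩ := exists_jetFmul_eq_sum e x he hx μ
  have hzero : P 0 := by
    convert jet 0
    exact Subtype.ext (funext fun p => (map_zero (jetAt I F E p)).symm)
  refine of_jetFmul χ μ hχ (hμ ▸ Finset.sum_induction _ P add hzero fun a _ => jetFmul _ _ ?_)
  rcases a with i | ⟨k, i⟩
  · exact jet _
  · have hsub : jetFrame e x (.inr (k, i)) = OmniLie.jet (fmul (x.coord k) (e.sec i)) +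
        OmniLie.jetFmul (-x.coord k) (OmniLie.jet (e.sec i)) :=
      Subtype.ext <| funext fun p => Subtype.ext <| LinearMap.ext fun δ => by
        change gaugeOp δ _ - x.coord k p • gaugeOp δ (e.sec i) =
          gaugeOp δ _ + -x.coord k p • gaugeOp δ (e.sec i)
        rw [neg_smul, sub_eq_add_neg]
    exact hsub ▸ add _ _ (jet _) (jetFmul _ _ (jet _))

end Jets

section GaugeExt

variable (F E) in
theorem nontrivial_fiber [Nontrivial F] (m : M) : Nontrivial (E m) :=
  ((trivializationAt F E m).linearEquivAt ℝ m
    (mem_baseSet_trivializationAt F E m)).toEquiv.nontrivial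

variable [IsManifold I ∞ M] [FiniteDimensional ℝ B] [T2Space M]
  [FiniteDimensional ℝ F] [ContMDiffVectorBundle ∞ F E I]

theorem gauge_ext_of_op [Nontrivial F] {m : M} {δ δ' : Gauge I F E m}
    (h : ∀ u, gaugeOp δ u = gaugeOp δ' u) : δ = δ' := by
  have := nontrivial_fiber F E m
  obtain ⟨y, hy⟩ := exists_ne (0 : E m)
  obtain ⟨u, rfl⟩ := exists_sec_eq (I := I) (F := F) y
  refine gauge_ext h (tangent_ext fun f => smul_left_injective ℝ hy ?_)
  have hfu := h (fmul f u)
  rwa [gaugeOp_fmul, gaugeOp_fmul, h, add_right_inj] at hfu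

theorem gaugeSec_ext_of_act [Nontrivial F] {d d' : GaugeSec I F E}
    (h : ∀ u, act d u = act d' u) : d = d' :=
  Subtype.ext (funext fun m => gauge_ext_of_op fun u => congrArg (evalAt I F E m) (h u))

end GaugeExt

section LieDerivative

variable [IsManifold I ∞ M] [FiniteDimensional ℝ B] (d r : GaugeSec I F E)

theorem act_gaugeBracket (u : Sec I F E) :
    act (gaugeBracket d r) u = act d (act r u) - act r (act d u) :=
  rfl

/-- The section `⟨𝓛_𝔡 μ, 𝔯⟩_E` of `E`, without reference to `𝓛_𝔡 μ`. -/
def lieDerivativePair (μ : JetSec I F E) : Sec I F E :=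
  act d (pair μ r) - pair μ (gaugeBracket d r)

theorem lieDerivativePair_jet (u : Sec I F E) :
    lieDerivativePair d r (jet u) = act r (act d u) :=
  sub_sub_cancel (act d (act r u)) (act r (act d u))

theorem lieDerivativePair_add (μ ν : JetSec I F E) :
    lieDerivativePair d r (μ + ν) = lieDerivativePair d r μ + lieDerivativePair d r ν := by
  change act d (pair μ r + pair ν r) - (pair μ _ + pair ν _) = _
  rw [map_add, add_sub_add_comm]
  rfl

theorem lieDerivativePair_jetFmul (f : C^∞⟮I, M; ℝ⟯) (μ : JetSec I F E) (m : M) :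
    lieDerivativePair d r (jetFmul f μ) m = f m • lieDerivativePair d r μ m +
      mvfderiv I f m (gaugeAnchor (d.1 m)) • (μ.1 m).1 (r.1 m) := by
  change gaugeOp (d.1 m) (fmul f (pair μ r)) - f m • pair μ (gaugeBracket d r) m =
    f m • (gaugeOp (d.1 m) (pair μ r) - pair μ (gaugeBracket d r) m) + _
  rw [gaugeOp_fmul, smul_sub, add_sub_right_comm]
  rfl

variable [T2Space M] [FiniteDimensional ℝ F] [ContMDiffVectorBundle ∞ F E I]

theorem exists_lieDerivativePair_eq (μ : JetSec I F E) (m : M) :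
    ∃ lam : Jet I F E m, ∀ r, lieDerivativePair d r μ m = lam.1 (r.1 m) := by
  induction μ using jetSec_induction (I := I) (F := F) (E := E) (m := m) with
  | jet u =>
    exact ⟨jetAt I F E m (act d u), fun r =>
      congrArg (evalAt I F E m) (lieDerivativePair_jet d r u)⟩
  | add μ ν hμ hν =>
    obtain ⟨lam, hlam⟩ := hμ
    obtain ⟨lam', hlam'⟩ := hν
    refine ⟨lam + lam', fun r => ?_⟩
    rw [lieDerivativePair_add]
    exact congrArg₂ (· + ·) (hlam r) (hlam' r)
  | jetFmul f μ hμ =>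
    obtain ⟨lam, hlam⟩ := hμ
    refine ⟨f m • lam + mvfderiv I f m (gaugeAnchor (d.1 m)) • μ.1 m, fun r => ?_⟩
    rw [lieDerivativePair_jetFmul, hlam]
    rfl
  | of_jetFmul χ μ hχ hμ =>
    obtain ⟨lam, hlam⟩ := hμ
    refine ⟨lam - mvfderiv I χ m (gaugeAnchor (d.1 m)) • μ.1 m, fun r => ?_⟩
    have h := lieDerivativePair_jetFmul d r χ μ m
    rw [hlam, hχ, one_smul] at h
    exact eq_sub_of_add_eq h.symm

theorem exists_isLieDerivative (μ : JetSec I F E) : ∃ lam, IsLieDerivative d μ lam := by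
  choose lam hlam using exists_lieDerivativePair_eq d μ
  refine ⟨⟨lam, fun r hr => ?_⟩, fun r => ContMDiffSection.ext fun m => (hlam m r).symm⟩
  convert (lieDerivativePair d ⟨r, hr⟩ μ).contMDiff using 3 with m
  exact (hlam m ⟨r, hr⟩).symm

theorem exists_isDorfmanBracket (X Y : OmniSec I F E) : ∃ Z, IsDorfmanBracket X Y Z := by
  obtain ⟨lam₁, h₁⟩ := exists_isLieDerivative X.1 Y.2
  obtain ⟨lam₂, h₂⟩ := exists_isLieDerivative Y.1 X.2
  exact ⟨_, lam₁, lam₂, h₁, h₂, rfl⟩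

end LieDerivative

theorem omniPairing_eq_zero_iff {m : M} {X Y : Omni I F E m} :
    omniPairing X Y = 0 ↔ Y.2.1 X.1 = -X.2.1 Y.1 :=
  (smul_eq_zero_iff_right (by norm_num)).trans add_eq_zero_iff_eq_neg

namespace JetToGauge

variable [IsManifold I ∞ M] (φ ψ : JetToGauge I F E)

/-- The map `Γ(𝔍E) → Γ(𝔇E)` induced by a bundle map. -/
def mapSec : JetSec I F E →ₗ[ℝ] GaugeSec I F E where
  toFun μ := ⟨fun m => φ.toFun m (μ.1 m), φ.smooth μ.1 μ.2⟩
  map_add' μ ν := Subtype.ext (funext fun m => map_add (φ.toFun m) (μ.1 m) (ν.1 m))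
  map_smul' c μ := Subtype.ext (funext fun m => map_smul (φ.toFun m) c (μ.1 m))

/-- Skew-symmetry of a bundle map `𝔍E → 𝔇E` with respect to the `E`-valued pairing. -/
def IsSkew : Prop :=
  ∀ (m : M) (μ ν : Jet I F E m), ν.1 (φ.toFun m μ) = -μ.1 (φ.toFun m ν)

variable {φ ψ} {m : M}

theorem mem_graph_iff {X : Omni I F E m} : X ∈ φ.graph m ↔ X.1 = φ.toFun m X.2 :=
  ⟨fun ⟨_, hX⟩ => hX ▸ rfl, fun h => ⟨X.2, Prod.ext h.symm rfl⟩⟩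

theorem mk_mem_graph (μ : Jet I F E m) : (φ.toFun m μ, μ) ∈ φ.graph m :=
  ⟨μ, rfl⟩

theorem toFun_eq_of_graph_eq (h : φ.graph = ψ.graph) : φ.toFun = ψ.toFun :=
  funext fun _ => LinearMap.ext fun μ => mem_graph_iff.1 (h ▸ mk_mem_graph (φ := φ) μ)

theorem isSkew_iff : φ.IsSkew ↔ ∀ m, IsIsotropic (φ.graph m) := by
  refine ⟨fun h _ X hX Y hY => ?_, fun h _ μ ν =>
    omniPairing_eq_zero_iff.1 (h _ _ (mk_mem_graph μ) _ (mk_mem_graph ν))⟩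
  rw [omniPairing_eq_zero_iff, mem_graph_iff.1 hX, mem_graph_iff.1 hY]
  exact h _ X.2 Y.2

theorem IsSkew.pair_mapSec (h : φ.IsSkew) (μ ν : JetSec I F E) :
    pair ν (φ.mapSec μ) = -pair μ (φ.mapSec ν) :=
  ContMDiffSection.ext fun m => h m (μ.1 m) (ν.1 m)

theorem IsSkew.act_mapSec (h : φ.IsSkew) (μ : JetSec I F E) (u : Sec I F E) :
    act (φ.mapSec μ) u = -pair μ (φ.mapSec (jet u)) :=
  h.pair_mapSec μ (jet u)

variable [FiniteDimensional ℝ B] [T2Space M] [FiniteDimensional ℝ F] [ContMDiffVectorBundle ∞ F E I]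

variable (φ) in
theorem isSubbundle_graph : IsSubbundle φ.graph := by
  intro m
  obtain ⟨e, he⟩ := exists_localFrame (I := I) (F := F) (E := E) m
  obtain ⟨x, hx⟩ := exists_localCoordinates (I := I) m
  let σ := (Fintype.equivFin (Fin (Module.finrank ℝ F) ⊕
    Fin (Module.finrank ℝ B) × Fin (Module.finrank ℝ F))).symm
  refine ⟨_, fun a => (φ.mapSec (jetFrame e x (σ a)), jetFrame e x (σ a)), ?_⟩
  filter_upwards [e.isOpen_dom.mem_nhds he, x.isOpen_dom.mem_nhds hx] with p hpe hpx
  change LinearIndependent ℝ ((φ.toFun p).prod .id ∘ (fun a => (jetFrame e x a).1 p) ∘ σ) ∧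
    Submodule.span ℝ (Set.range ((φ.toFun p).prod .id ∘ (fun a => (jetFrame e x a).1 p) ∘ σ)) = _
  constructor
  · exact ((linearIndependent_jetFrame e x hpe hpx).comp σ σ.injective).map' _ <|
      LinearMap.ker_eq_bot.2 fun _ _ h => congrArg Prod.snd h
  · rw [Set.range_comp, σ.surjective.range_comp, Submodule.span_image, span_jetFrame e x hpe hpx,
      Submodule.map_top]
    rfl

theorem IsSkew.maximal_graph [Nontrivial F] (h : φ.IsSkew) (m : M) :
    Maximal IsIsotropic (φ.graph m) := by
  refine ⟨isSkew_iff.1 h m, fun L hL hle X hX => mem_graph_iff.2 (gauge_ext_of_op fun u => ?_)⟩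
  have hXu := omniPairing_eq_zero_iff.1 (hL X hX _ (hle (mk_mem_graph (jetAt I F E m u))))
  exact hXu.trans (h m X.2 (jetAt I F E m u)).symm

end JetToGauge

section GaugeBracket

variable [IsManifold I ∞ M] [FiniteDimensional ℝ B] [T2Space M]
  [FiniteDimensional ℝ F] [ContMDiffVectorBundle ∞ F E I] [Nontrivial F]

theorem gaugeBracket_skew (d r : GaugeSec I F E) : gaugeBracket d r = -gaugeBracket r d :=
  gaugeSec_ext_of_act fun u => (neg_sub (act r (act d u)) (act d (act r u))).symm

theorem pair_gaugeBracket_skew (μ : JetSec I F E) (d r : GaugeSec I F E) :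
    pair μ (gaugeBracket d r) = -pair μ (gaugeBracket r d) := by
  rw [gaugeBracket_skew]
  exact ContMDiffSection.ext fun m => map_neg (μ.1 m).1 ((gaugeBracket r d).1 m)

end GaugeBracket

namespace JetToGauge

variable [IsManifold I ∞ M] {φ : JetToGauge I F E}

theorem forall_omniAt_mem_graph_iff {X : OmniSec I F E} :
    (∀ m, omniAt X m ∈ φ.graph m) ↔ X.1 = φ.mapSec X.2 :=
  ⟨fun h => Subtype.ext (funext fun m => mem_graph_iff.1 (h m)),
    fun h m => mem_graph_iff.2 (congrArg (fun d => d.1 m) h)⟩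

variable [FiniteDimensional ℝ B]

theorem isSkew_of_isDirac (h : IsDirac φ.graph) : φ.IsSkew :=
  isSkew_iff.2 fun m => (h.maximal_isotropic m).1

theorem IsSkew.act_mapSec_sub_of_isDorfmanBracket (h : φ.IsSkew) {μ ν : JetSec I F E}
    {Z : OmniSec I F E} (hZ : IsDorfmanBracket (φ.mapSec μ, μ) (φ.mapSec ν, ν) Z) (w : Sec I F E) :
    act (φ.mapSec Z.2) w - act Z.1 w =
      pair ν (gaugeBracket (φ.mapSec μ) (φ.mapSec (jet w))) -
        pair μ (gaugeBracket (φ.mapSec ν) (φ.mapSec (jet w))) -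
      act (φ.mapSec (jet w)) (pair μ (φ.mapSec ν)) := by
  obtain ⟨lam₁, lam₂, h₁, h₂, rfl⟩ := hZ
  have hpair (κ : JetSec I F E) : pair κ (φ.mapSec (jet w)) = -act (φ.mapSec κ) w :=
    h.pair_mapSec (jet w) κ
  have hsum := h.act_mapSec (lam₁ - lam₂ + jet (pair μ (φ.mapSec ν))) w
  change _ = -(pair lam₁ (φ.mapSec (jet w)) - pair lam₂ (φ.mapSec (jet w)) +
    act (φ.mapSec (jet w)) (pair μ (φ.mapSec ν))) at hsum
  have hνw := (congrArg (act (φ.mapSec μ)) (hpair ν)).trans (map_neg _ _)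
  have hμw := (congrArg (act (φ.mapSec ν)) (hpair μ)).trans (map_neg _ _)
  linear_combination (norm := module) hsum - h₁ (φ.mapSec (jet w)) + h₂ (φ.mapSec (jet w)) - hνw +
    hμw - act_gaugeBracket (φ.mapSec μ) (φ.mapSec ν) w

variable [T2Space M] [FiniteDimensional ℝ F] [ContMDiffVectorBundle ∞ F E I] [Nontrivial F]

theorem IsSkew.forall_omniAt_mem_graph_iff_of_isDorfmanBracket (h : φ.IsSkew)
    {μ ν : JetSec I F E} {Z : OmniSec I F E}
    (hZ : IsDorfmanBracket (φ.mapSec μ, μ) (φ.mapSec ν, ν) Z) :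
    (∀ m, omniAt Z m ∈ φ.graph m) ↔ ∀ w : Sec I F E,
      pair ν (gaugeBracket (φ.mapSec μ) (φ.mapSec (jet w))) -
        pair μ (gaugeBracket (φ.mapSec ν) (φ.mapSec (jet w))) =
      act (φ.mapSec (jet w)) (pair μ (φ.mapSec ν)) := by
  have hact (w : Sec I F E) : act Z.1 w = act (φ.mapSec Z.2) w ↔ _ :=
    eq_comm.trans (eq_iff_eq_of_sub_eq_sub (h.act_mapSec_sub_of_isDorfmanBracket hZ w))
  exact forall_omniAt_mem_graph_iff.trans
    ⟨fun hmem w => (hact w).1 (congrArg (act · w) hmem),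
      fun hinv => gaugeSec_ext_of_act fun w => (hact w).2 (hinv w)⟩

theorem IsSkew.isDirac_graph_iff (h : φ.IsSkew) :
    IsDirac φ.graph ↔ ∀ (μ ν : JetSec I F E) (w : Sec I F E),
      pair ν (gaugeBracket (φ.mapSec μ) (φ.mapSec (jet w))) -
        pair μ (gaugeBracket (φ.mapSec ν) (φ.mapSec (jet w))) =
      act (φ.mapSec (jet w)) (pair μ (φ.mapSec ν)) := by
  refine ⟨fun hD μ ν => ?_, fun hinv =>
    ⟨φ.isSubbundle_graph, h.maximal_graph, fun (d, μ) (r, ν) hX hY => ?_⟩⟩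
  · exact (hD.closed (φ.mapSec μ, μ) (φ.mapSec ν, ν) (forall_omniAt_mem_graph_iff.2 rfl)
      (forall_omniAt_mem_graph_iff.2 rfl)).elim fun Z hZ =>
        (h.forall_omniAt_mem_graph_iff_of_isDorfmanBracket hZ.1).1 hZ.2
  · obtain rfl : d = φ.mapSec μ := forall_omniAt_mem_graph_iff.1 hX
    obtain rfl : r = φ.mapSec ν := forall_omniAt_mem_graph_iff.1 hY
    exact (exists_isDorfmanBracket (φ.mapSec μ, μ) (φ.mapSec ν, ν)).imp fun Z hZ =>
      ⟨hZ, (h.forall_omniAt_mem_graph_iff_of_isDorfmanBracket hZ).2 (hinv μ ν)⟩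

end JetToGauge

namespace LieAlgebroid

variable [IsManifold I ∞ M] (A : LieAlgebroid I F E)

theorem bracket_skew (u v : Sec I F E) : A.bracket u v = -A.bracket v u :=
  (LinearMap.IsAlt.neg A.bracket_self v u).symm

/-- The adjoint representation `u ↦ [u, ·]`, with values in `Γ(𝔇E)`. -/
def ad : Sec I F E →ₗ[ℝ] GaugeSec I F E where
  toFun u := ⟨fun m => ⟨(evalAt I F E m ∘ₗ A.bracket u, A.anchor m (u m)),
    fun f v => A.leibniz u v f m⟩, fun v => (A.bracket u v).contMDiff,
    A.smooth_anchor.comp u.contMDiff⟩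
  map_add' u v := Subtype.ext <| funext fun m => gauge_ext
    (fun w => congrArg (evalAt I F E m) (LinearMap.map_add₂ A.bracket u v w))
    (map_add (A.anchor m) (u m) (v m))
  map_smul' c u := Subtype.ext <| funext fun m => gauge_ext
    (fun w => congrArg (evalAt I F E m) (LinearMap.map_smul₂ A.bracket c u w))
    (map_smul (A.anchor m) c (u m))

theorem act_ad (u v : Sec I F E) : act (A.ad u) v = A.bracket u v :=
  rfl

theorem ad_fmul (f : C^∞⟮I, M; ℝ⟯) (u : Sec I F E) (m : M) :
    (A.ad (fmul f u)).1 m = f m • (A.ad u).1 m -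
      gaugeOfEnd ((((mvfderiv I f m : TangentSpace I m →L[ℝ] ℝ) : TangentSpace I m →ₗ[ℝ] ℝ) ∘ₗ
        A.anchor m).smulRight (u m)) := by
  refine gauge_ext (fun w => ?_) ?_
  · change A.bracket (fmul f u) w m =
      f m • A.bracket u w m - mvfderiv I f m (A.anchor m (w m)) • u m
    rw [A.bracket_skew, A.bracket_skew u w]
    change -A.bracket w (fmul f u) m = f m • -A.bracket w u m - _
    rw [A.leibniz, smul_neg, neg_add, sub_eq_add_neg]
  · exact (map_smul (A.anchor m) (f m) (u m)).trans (sub_zero _).symm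

/-- The bundle map `𝔍E → 𝔇E` of a Lie algebroid. It is determined by `𝕕u ↦ [u, ·]`, and defined
on all of `𝔍E` by skew-symmetry: `μ` goes to `v ↦ -⟨μ, [v, ·]⟩_E`, with anchor `ρ (μ(1))`. -/
def toJetToGauge : JetToGauge I F E where
  toFun m :=
    { toFun μ := ⟨(-(μ.1 ∘ₗ LinearMap.proj m ∘ₗ (GaugeSec I F E).subtype ∘ₗ A.ad),
          A.anchor m (μ.1 ((gaugeOne I F E).1 m))), fun f u => by
        change -μ.1 ((A.ad (fmul f u)).1 m) = f m • -μ.1 ((A.ad u).1 m) +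
          mvfderiv I f m (A.anchor m (μ.1 ((gaugeOne I F E).1 m))) • u m
        rw [ad_fmul, map_sub, map_smul, μ.2, neg_sub, smul_neg, neg_add_eq_sub]
        rfl⟩
      map_add' μ ν := gauge_ext
        (fun u => neg_add (μ.1 ((A.ad u).1 m)) (ν.1 ((A.ad u).1 m))) (map_add (A.anchor m) _ _)
      map_smul' c μ := gauge_ext
        (fun u => (smul_neg c (μ.1 ((A.ad u).1 m))).symm) (map_smul (A.anchor m) _ _) }
  smooth μ hμ := ⟨fun u => (-pair ⟨μ, hμ⟩ (A.ad u)).contMDiff,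
    A.smooth_anchor.comp (pair ⟨μ, hμ⟩ (gaugeOne I F E)).contMDiff⟩

theorem act_mapSec_toJetToGauge (μ : JetSec I F E) (v : Sec I F E) :
    act (A.toJetToGauge.mapSec μ) v = -pair μ (A.ad v) :=
  rfl

theorem toJetToGauge_jetAt (u : Sec I F E) (m : M) :
    A.toJetToGauge.toFun m (jetAt I F E m u) = (A.ad u).1 m :=
  gauge_ext (fun v => (congrArg (evalAt I F E m) (A.bracket_skew u v)).symm) rfl

theorem mapSec_toJetToGauge_jet (u : Sec I F E) : A.toJetToGauge.mapSec (jet u) = A.ad u :=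
  Subtype.ext (funext fun m => A.toJetToGauge_jetAt u m)

variable [FiniteDimensional ℝ B] [T2Space M] [FiniteDimensional ℝ F] [ContMDiffVectorBundle ∞ F E I]

theorem isSkew_toJetToGauge : A.toJetToGauge.IsSkew := by
  intro m μ ν
  obtain ⟨u, rfl⟩ := exists_jetAt_eq μ
  obtain ⟨v, rfl⟩ := exists_jetAt_eq ν
  rw [toJetToGauge_jetAt, toJetToGauge_jetAt]
  exact congrArg (evalAt I F E m) (A.bracket_skew u v)

theorem graph_toJetToGauge_injective {A A' : LieAlgebroid I F E}
    (h : A.toJetToGauge.graph = A'.toJetToGauge.graph) : A = A' := by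
  have had (u : Sec I F E) (m : M) : (A.ad u).1 m = (A'.ad u).1 m := by
    rw [← toJetToGauge_jetAt, ← toJetToGauge_jetAt, JetToGauge.toFun_eq_of_graph_eq h]
  refine LieAlgebroid.ext (funext fun m => LinearMap.ext fun v => ?_)
    (LinearMap.ext fun u => LinearMap.ext fun v => ContMDiffSection.ext fun m => ?_)
  · obtain ⟨u, rfl⟩ := exists_sec_eq (I := I) (F := F) v
    exact congrArg gaugeAnchor (had u m)
  · exact congrArg (fun δ => gaugeOp δ v) (had u m)

variable [Nontrivial F]

theorem gaugeBracket_ad (u v : Sec I F E) :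
    gaugeBracket (A.ad u) (A.ad v) = A.ad (A.bracket u v) := by
  refine gaugeSec_ext_of_act fun w => ?_
  change A.bracket u (A.bracket v w) - A.bracket v (A.bracket u w) = A.bracket (A.bracket u v) w
  rw [A.bracket_skew (A.bracket u v) w, A.bracket_skew u w, map_neg, sub_neg_eq_add]
  exact eq_neg_of_add_eq_zero_left (A.jacobi u v w)

theorem gaugeBracket_ad_mapSec {w : Sec I F E} {μ lam : JetSec I F E}
    (h : IsLieDerivative (A.ad w) μ lam) :
    gaugeBracket (A.ad w) (A.toJetToGauge.mapSec μ) = A.toJetToGauge.mapSec lam := by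
  refine gaugeSec_ext_of_act fun v => ?_
  rw [act_gaugeBracket, act_mapSec_toJetToGauge, act_mapSec_toJetToGauge, act_mapSec_toJetToGauge,
    h, gaugeBracket_ad, map_neg, act_ad]
  abel

theorem pair_gaugeBracket_mapSec_ad (μ ν : JetSec I F E) (w : Sec I F E) :
    pair ν (gaugeBracket (A.toJetToGauge.mapSec μ) (A.ad w)) =
      act (A.ad w) (pair μ (A.toJetToGauge.mapSec ν)) -
        pair μ (gaugeBracket (A.ad w) (A.toJetToGauge.mapSec ν)) := by
  have ⟨lam, hlam⟩ := exists_isLieDerivative (A.ad w) μ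
  calc
    _ = -pair ν (gaugeBracket (A.ad w) (A.toJetToGauge.mapSec μ)) :=
        pair_gaugeBracket_skew ν _ _
    _ = -pair ν (A.toJetToGauge.mapSec lam) :=
        congrArg (fun d => -pair ν d) (A.gaugeBracket_ad_mapSec hlam)
    _ = pair lam (A.toJetToGauge.mapSec ν) := (A.isSkew_toJetToGauge.pair_mapSec ν lam).symm
    _ = _ := hlam _

theorem pair_gaugeBracket_mapSec_ad_sub (μ ν : JetSec I F E) (w : Sec I F E) :
    pair ν (gaugeBracket (A.toJetToGauge.mapSec μ) (A.ad w)) -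
        pair μ (gaugeBracket (A.toJetToGauge.mapSec ν) (A.ad w)) =
      act (A.ad w) (pair μ (A.toJetToGauge.mapSec ν)) := by
  rw [A.pair_gaugeBracket_mapSec_ad, pair_gaugeBracket_skew μ (A.toJetToGauge.mapSec ν) (A.ad w)]
  abel

theorem isDirac_graph_toJetToGauge : IsDirac A.toJetToGauge.graph := by
  refine A.isSkew_toJetToGauge.isDirac_graph_iff.2 fun μ ν w => ?_
  rw [mapSec_toJetToGauge_jet]
  exact A.pair_gaugeBracket_mapSec_ad_sub μ ν w

end LieAlgebroid

section Anchor

variable (F E) in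
theorem finrank_fiber (m : M) : Module.finrank ℝ (E m) = Module.finrank ℝ F :=
  ((trivializationAt F E m).linearEquivAt ℝ m (mem_baseSet_trivializationAt F E m)).finrank_eq

variable {m : M} {D : Sec I F E →ₗ[ℝ] Gauge I F E m}

theorem anchor_fmul_sub_smul_add_eq_zero (hD : ∀ u v, gaugeOp (D u) v = -gaugeOp (D v) u)
    (f g : C^∞⟮I, M; ℝ⟯) (u v : Sec I F E) :
    mvfderiv I f m (gaugeAnchor (D (fmul g v)) - g m • gaugeAnchor (D v)) • u m +
      mvfderiv I g m (gaugeAnchor (D (fmul f u)) - f m • gaugeAnchor (D u)) • v m = 0 := by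
  have expand_right : gaugeOp (D (fmul f u)) (fmul g v) =
      g m • -(f m • gaugeOp (D v) u + mvfderiv I f m (gaugeAnchor (D v)) • u m) +
        mvfderiv I g m (gaugeAnchor (D (fmul f u))) • v m := by
    rw [gaugeOp_fmul, hD (fmul f u) v, gaugeOp_fmul]
  have expand_left : gaugeOp (D (fmul f u)) (fmul g v) =
      -(f m • -(g m • -gaugeOp (D v) u + mvfderiv I g m (gaugeAnchor (D u)) • v m) +
        mvfderiv I f m (gaugeAnchor (D (fmul g v))) • u m) := by
    rw [hD, gaugeOp_fmul, hD (fmul g v) u, gaugeOp_fmul, hD u v]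
  rw [map_sub, map_sub, map_smul, map_smul, smul_eq_mul, smul_eq_mul]
  linear_combination (norm := module) expand_left - expand_right

variable [IsManifold I ∞ M] [FiniteDimensional ℝ B] [T2Space M]

theorem anchor_fmul_of_linearIndependent (hD : ∀ u v, gaugeOp (D u) v = -gaugeOp (D v) u)
    (f : C^∞⟮I, M; ℝ⟯) {u v : Sec I F E} (huv : LinearIndependent ℝ ![u m, v m]) :
    gaugeAnchor (D (fmul f u)) = f m • gaugeAnchor (D u) := by
  refine tangent_ext fun g => ?_
  rw [← sub_eq_zero, ← map_sub]
  exact (LinearIndependent.pair_iff.1 huv _ _ (anchor_fmul_sub_smul_add_eq_zero hD f g u v)).2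

variable [FiniteDimensional ℝ F] [ContMDiffVectorBundle ∞ F E I]

theorem anchor_fmul_of_apply_ne_zero (hF : 2 ≤ Module.finrank ℝ F)
    (hD : ∀ u v, gaugeOp (D u) v = -gaugeOp (D v) u) (f : C^∞⟮I, M; ℝ⟯) {u : Sec I F E}
    (hu : u m ≠ 0) : gaugeAnchor (D (fmul f u)) = f m • gaugeAnchor (D u) := by
  rw [← finrank_fiber F E m] at hF
  obtain ⟨y, hy⟩ := exists_linearIndependent_pair_of_one_lt_finrank hF hu
  obtain ⟨v, rfl⟩ := exists_sec_eq (I := I) (F := F) y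
  exact anchor_fmul_of_linearIndependent hD f hy

theorem anchor_fmul_of_skew (hF : 2 ≤ Module.finrank ℝ F)
    (hD : ∀ u v, gaugeOp (D u) v = -gaugeOp (D v) u) (f : C^∞⟮I, M; ℝ⟯) (u : Sec I F E) :
    gaugeAnchor (D (fmul f u)) = f m • gaugeAnchor (D u) := by
  by_cases hu : u m = 0
  · have : Nontrivial (E m) := Module.nontrivial_of_finrank_pos (R := ℝ)
      (by rw [finrank_fiber F E m]; omega)
    obtain ⟨y, hy⟩ := exists_ne (0 : E m)
    obtain ⟨v, rfl⟩ := exists_sec_eq (I := I) (F := F) y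
    have hadd (a b : Sec I F E) : gaugeAnchor (D (a + b)) = gaugeAnchor (D a) + gaugeAnchor (D b) :=
      congrArg gaugeAnchor (map_add D a b)
    have hfmul : fmul f (u + v) = fmul f u + fmul f v :=
      ContMDiffSection.ext fun p => smul_add (f p) (u p) (v p)
    have huv : (u + v) m ≠ 0 := by
      rwa [ContMDiffSection.coe_add, Pi.add_apply, hu, zero_add]
    have h := anchor_fmul_of_apply_ne_zero hF hD f huv
    rw [hfmul, hadd, hadd, anchor_fmul_of_apply_ne_zero hF hD f hy, smul_add] at h
    exact add_right_cancel h
  · exact anchor_fmul_of_apply_ne_zero hF hD f hu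

end Anchor

namespace JetToGauge

variable [IsManifold I ∞ M] (φ : JetToGauge I F E)

/-- The bracket `[u, v] = φ(𝕕u) v` on `Γ(E)`. -/
def bracket : Sec I F E →ₗ[ℝ] Sec I F E →ₗ[ℝ] Sec I F E :=
  LinearMap.mk₂ ℝ (fun u v => act (φ.mapSec (jet u)) v)
    (fun u u' v => ContMDiffSection.ext fun m => by
      change gaugeOp (φ.toFun m (jetAt I F E m (u + u'))) v = _
      rw [map_add, map_add]
      rfl)
    (fun c u v => ContMDiffSection.ext fun m => by
      change gaugeOp (φ.toFun m (jetAt I F E m (c • u))) v = _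
      rw [map_smul, map_smul]
      rfl)
    (fun u => map_add (act (φ.mapSec (jet u)))) (fun c u => map_smul (act (φ.mapSec (jet u))) c)

variable {φ}

theorem IsSkew.bracket_skew (h : φ.IsSkew) (u v : Sec I F E) :
    φ.bracket u v = -φ.bracket v u :=
  h.act_mapSec (jet u) v

theorem IsSkew.bracket_self (h : φ.IsSkew) (u : Sec I F E) : φ.bracket u u = 0 :=
  have : IsAddTorsionFree (Sec I F E) := .of_isTorsionFree ℝ _
  self_eq_neg.1 (h.bracket_skew u u)

variable [FiniteDimensional ℝ B] [T2Space M] [FiniteDimensional ℝ F] [ContMDiffVectorBundle ∞ F E I]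

theorem bracket_jacobi [Nontrivial F] (h : IsDirac φ.graph) (u v w : Sec I F E) :
    φ.bracket u (φ.bracket v w) + φ.bracket v (φ.bracket w u) + φ.bracket w (φ.bracket u v) =
      0 := by
  have hskew := isSkew_of_isDirac h
  have hinv : φ.bracket u (φ.bracket w v) - φ.bracket w (φ.bracket u v) -
      (φ.bracket v (φ.bracket w u) - φ.bracket w (φ.bracket v u)) =
      φ.bracket w (φ.bracket v u) :=
    hskew.isDirac_graph_iff.1 h (jet u) (jet v) w
  have hvw := (congrArg (φ.bracket u) (hskew.bracket_skew v w)).trans (map_neg _ _)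
  linear_combination (norm := module) hvw - hinv

theorem IsSkew.exists_anchor (hF : 2 ≤ Module.finrank ℝ F) (h : φ.IsSkew) (m : M) :
    ∃ a : E m →ₗ[ℝ] TangentSpace I m,
      ∀ u : Sec I F E, gaugeAnchor (φ.toFun m (jetAt I F E m u)) = a (u m) :=
  exists_linearMap_of_tensorial
    (T := LinearMap.snd ℝ _ _ ∘ₗ (Gauge I F E m).subtype ∘ₗ φ.toFun m ∘ₗ jetAt I F E m)
    (anchor_fmul_of_skew (D := φ.toFun m ∘ₗ jetAt I F E m) hF fun u v =>
      congrArg (evalAt I F E m) (h.bracket_skew u v))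

variable (φ) in
/-- The Lie algebroid with bracket `φ.bracket` and a given anchor. -/
def lieAlgebroid [Nontrivial F] (h : IsDirac φ.graph) (a : Π m : M, E m →ₗ[ℝ] TangentSpace I m)
    (ha : ∀ (m : M) (u : Sec I F E), gaugeAnchor (φ.toFun m (jetAt I F E m u)) = a m (u m)) :
    LieAlgebroid I F E where
  anchor := a
  smooth_anchor := contMDiff_totalSpace_of_sec a fun u => by
    simp only [← ha]
    exact (φ.mapSec (jet u)).2.2
  bracket := φ.bracket
  bracket_self := (isSkew_of_isDirac h).bracket_self
  jacobi := bracket_jacobi h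
  leibniz u v f m := by
    rw [← ha]
    exact gaugeOp_fmul (φ.toFun m (jetAt I F E m u)) f v

theorem exists_graph_toJetToGauge_eq (hF : 2 ≤ Module.finrank ℝ F) (h : IsDirac φ.graph) :
    ∃ A : LieAlgebroid I F E, A.toJetToGauge.graph = φ.graph := by
  have : Nontrivial F := Module.nontrivial_of_finrank_pos (R := ℝ) (by omega)
  have hskew := isSkew_of_isDirac h
  choose a ha using hskew.exists_anchor hF
  let A := φ.lieAlgebroid h a ha
  have had (m : M) (v : Sec I F E) : φ.toFun m (jetAt I F E m v) = (A.ad v).1 m :=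
    gauge_ext (fun _ => rfl) (ha m v)
  have hφ (m : M) : A.toJetToGauge.toFun m = φ.toFun m := LinearMap.ext fun μ =>
    gauge_ext_of_op fun v =>
      (congrArg (fun δ => -μ.1 δ) (had m v).symm).trans (hskew m μ (jetAt I F E m v)).symm
  refine ⟨A, funext fun m => ?_⟩
  rw [graph, graph, hφ]

end JetToGauge

end OmniLie

end

theorem mainTheorem1_general
    {B : Type*} [NormedAddCommGroup B] [NormedSpace ℝ B] [FiniteDimensional ℝ B]
    {H : Type*} [TopologicalSpace H] (I : ModelWithCorners ℝ B H)
    {M : Type*} [TopologicalSpace M] [ChartedSpace H M] [IsManifold I ∞ M]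
    [T2Space M]
    (F : Type*) [NormedAddCommGroup F] [NormedSpace ℝ F] [FiniteDimensional ℝ F]
    (E : M → Type*) [TopologicalSpace (TotalSpace F E)]
    [∀ m, AddCommGroup (E m)] [∀ m, Module ℝ (E m)] [∀ m, TopologicalSpace (E m)]
    [FiberBundle F E] [VectorBundle ℝ F E] [ContMDiffVectorBundle ∞ F E I]
    (hrank : 2 ≤ Module.finrank ℝ F) :
    ∃ Θ : OmniLie.LieAlgebroid I F E ≃
        {L : Π m : M, Submodule ℝ (OmniLie.Omni I F E m) //
          OmniLie.IsDirac L ∧ ∃ φ : OmniLie.JetToGauge I F E, L = φ.graph},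
      ∀ A : OmniLie.LieAlgebroid I F E, ∃ φ : OmniLie.JetToGauge I F E,
        (Θ A).1 = φ.graph ∧
        ∀ (u : OmniLie.Sec I F E) (m : M),
          (∀ v : OmniLie.Sec I F E,
            OmniLie.gaugeOp (φ.toFun m ((OmniLie.jet u).1 m)) v = A.bracket u v m) ∧
          OmniLie.gaugeAnchor (φ.toFun m ((OmniLie.jet u).1 m)) = A.anchor m (u m) := by
  have : Nontrivial F := Module.nontrivial_of_finrank_pos (R := ℝ) (by omega)
  refine ⟨Equiv.ofBijective
    (fun A => ⟨A.toJetToGauge.graph, A.isDirac_graph_toJetToGauge, A.toJetToGauge, rfl⟩)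
    ⟨fun A A' h => OmniLie.LieAlgebroid.graph_toJetToGauge_injective (congrArg Subtype.val h), ?_⟩,
    fun A => ⟨A.toJetToGauge, rfl, fun u m => ⟨fun v => ?_, rfl⟩⟩⟩
  · rintro ⟨_, h, φ, rfl⟩
    obtain ⟨A, hA⟩ := OmniLie.JetToGauge.exists_graph_toJetToGauge_eq hrank h
    exact ⟨A, Subtype.ext hA⟩
  · exact congrArg (fun δ => OmniLie.gaugeOp δ v) (A.toJetToGauge_jetAt u m)

theorem mainTheorem1
    {B : Type*} [NormedAddCommGroup B] [NormedSpace ℝ B] [FiniteDimensional ℝ B]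
    {H : Type*} [TopologicalSpace H] (I : ModelWithCorners ℝ B H) [I.Boundaryless]
    {M : Type*} [TopologicalSpace M] [ChartedSpace H M] [IsManifold I ∞ M]
    [T2Space M] [SigmaCompactSpace M]
    (F : Type*) [NormedAddCommGroup F] [NormedSpace ℝ F] [FiniteDimensional ℝ F]
    (E : M → Type*) [TopologicalSpace (TotalSpace F E)]
    [∀ m, AddCommGroup (E m)] [∀ m, Module ℝ (E m)] [∀ m, TopologicalSpace (E m)]
    [FiberBundle F E] [VectorBundle ℝ F E] [ContMDiffVectorBundle ∞ F E I]
    (hrank : 2 ≤ Module.finrank ℝ F) :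
    ∃ Θ : OmniLie.LieAlgebroid I F E ≃
        {L : Π m : M, Submodule ℝ (OmniLie.Omni I F E m) //
          OmniLie.IsDirac L ∧ ∃ φ : OmniLie.JetToGauge I F E, L = φ.graph},
      ∀ A : OmniLie.LieAlgebroid I F E, ∃ φ : OmniLie.JetToGauge I F E,
        (Θ A).1 = φ.graph ∧
        ∀ (u : OmniLie.Sec I F E) (m : M),
          (∀ v : OmniLie.Sec I F E,
            OmniLie.gaugeOp (φ.toFun m ((OmniLie.jet u).1 m)) v = A.bracket u v m) ∧
          OmniLie.gaugeAnchor (φ.toFun m ((OmniLie.jet u).1 m)) = A.anchor m (u m) :=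
  mainTheorem1_general I F E hrank
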